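/- Let $a,b,c$ be nonzero real numbers and $\epsilon_0,d,m,w$ positive real numbers with $d^2\ne m$. Consider the Benney--Roskes/Zakharov--Rubenchik system for a complex function $\psi$ and a real function $\varphi$ of $(x,y,t)\in\mathbb R^3$, $$i\psi_t+a\psi_{xx}+\epsilon_0\psi_{yy}=(b-wm)|\psi|^2\psi-w\psi\,\{m\partial_t+(mc-d)\partial_y\}\varphi,$$ $$\varphi_{xx}+(1-mc^2)\varphi_{yy}-m\varphi_{tt}-2mc\,\varphi_{yt}=\{m\partial_t+(mc-d)\partial_y\}|\psi|^2 .$$ (1) The linear change of variables $t=m\xi+d\sqrt m\,\eta$, $y=(mc-d)\xi+\sqrt m(cd-1)\eta$ is invertible. If $(\psi,\varphi)$ is a smooth solution on $\mathbb R^3$ of the system above, then, in the variables $(x,\xi,\eta)$, renamed $(x,y,t)$, the pair $(\psi,\phi)$ with $\phi=\varphi_\xi$ is a solution of $$ia_1\psi_t+a\psi_{xx}+a_2\psi_{yy}+a_3\psi_{tt}+a_4\psi_{ty}+ia_5\psi_y=(b-wm)|\psi|^2\psi-w\psi\phi,$$ $$\phi_{xx}+\frac1{d^2-m}(\phi_{yy}-\phi_{tt})=(|\psi|^2)_{yy},\qquad(\ast)$$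 where $$a_1=\frac{d-mc}{(d^2-m)\sqrt m},\quad a_2=\frac{\epsilon_0d^2}{(d^2-m)^2},\quad a_3=\frac{\epsilon_0m}{(d^2-m)^2},\quad a_4=-\frac{2\epsilon_0d\sqrt m}{(d^2-m)^2},\quad a_5=\frac{dc-1}{d^2-m}.$$ (2) Write $\psi=u+iv$. On every nonempty connected open subset of the space $\mathbb R^6$ of the variables $(x,y,t,u,v,\phi)$, the smooth vector fields that are infinitesimal Lie point symmetries of $(\ast)$ (that is, fields $V$ whose second prolongation annihilates the equations of $(\ast)$ at every second-order jet over that subset which satisfies them) form a real Lie algebra of dimension exactly six, with basis (the restrictions of) $$\bar{\mathcal X}_1=\partial_t,\quad \bar{\mathcal X}_2=\partial_x,\quad \bar{\mathcal X}_3=\partial_y,\quad \bar{\mathcal X}_4=-v\partial_u+u\partial_v,$$ $$\bar{\mathcal X}_5=(dt+\sqrt m\,y)(-v\partial_u+u\partial_v)+\frac1{w\sqrt m}\partial_\phi,$$ $$\bar{\mathcal X}_6=(dt+\sqrt m\,y)^2(-v\partial_u+u\partial_v)+\frac{2(dt+\sqrt m\,y)}{w\sqrt m}\partial_\phi .$$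 (3) The commutators are $$[\bar{\mathcal X}_1,\bar{\mathcal X}_5]=d\,\bar{\mathcal X}_4,\quad[\bar{\mathcal X}_1,\bar{\mathcal X}_6]=2d\,\bar{\mathcal X}_5,\quad[\bar{\mathcal X}_3,\bar{\mathcal X}_5]=\sqrt m\,\bar{\mathcal X}_4,\quad[\bar{\mathcal X}_3,\bar{\mathcal X}_6]=2\sqrt m\,\bar{\mathcal X}_5,$$ and $[\bar{\mathcal X}_i,\bar{\mathcal X}_j]=0$ for all other pairs $i<j$. -/

import Mathlib

open scoped ContDiff

noncomputable section

namespace BRZR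

/-- The space of independent variables `(x, y, t)`, numbered `0, 1, 2`. -/
abbrev Base := Fin 3 → ℝ

/-- The space of real dependent variables `(u, v, φ)`, numbered `0, 1, 2`, where `ψ = u + i v`. -/
abbrev Fib := Fin 3 → ℝ

/-- The space of all variables `(x, y, t; u, v, φ)`. A vector field
`ξ^x ∂_x + ξ^y ∂_y + ξ^t ∂_t + η^u ∂_u + η^v ∂_v + η^φ ∂_φ` is a map `Total → Total`,
`z ↦ (ξ z, η z)`. -/
abbrev Total := Base × Fib

/-- Second-order jets: base point, values, first derivatives (`J.2.2.1 i` is the derivative with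
respect to the `i`-th variable) and second derivatives (`J.2.2.2 i j`). -/
abbrev Jet := Base × Fib × (Fin 3 → Fib) × (Fin 3 → Fin 3 → Fib)

/-- Partial derivative with respect to the `i`-th independent variable. -/
def pd {G : Type*} [NormedAddCommGroup G] [NormedSpace ℝ G] (i : Fin 3) (f : Base → G) :
    Base → G :=
  fun p => fderiv ℝ f p (Pi.single i 1)

/-- The second-order jet of `f` at `p`. -/
def jet (f : Base → Fib) (p : Base) : Jet :=
  (p, f p, fun i => pd i f p, fun i j => pd i (pd j f) p)

/-- The characteristic `Q = η - ∑ₖ ξ^k ∂ₖ f` of the vector field `V = (ξ, η)`, along `f`. -/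
def characteristic (V : Total → Total) (f : Base → Fib) : Base → Fib :=
  fun q => (V (q, f q)).2 - ∑ k, (V (q, f q)).1 k • pd k f q

/-- The second prolongation of the vector field `V = (ξ, η)`, a tangent vector of the jet space at
the second-order jet of `f` at `p`: its components are `ξ`, `η` and
`η_J = D_J Q + ∑ₖ ξ^k ∂ₖ ∂_J f` for `|J| = 1, 2`. Total derivatives are computed along `f`; the
derivatives of `f` of order three cancel, so that only the second-order jet of `f` matters. -/
def prolongation (V : Total → Total) (f : Base → Fib) (p : Base) : Jet :=
  ((V (p, f p)).1, (V (p, f p)).2,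
    fun i => pd i (characteristic V f) p + ∑ k, (V (p, f p)).1 k • pd k (pd i f) p,
    fun i j => pd i (pd j (characteristic V f)) p
      + ∑ k, (V (p, f p)).1 k • pd k (pd i (pd j f)) p)

/-- `V` is a (smooth) infinitesimal Lie point symmetry on the open set `Ω` of the second-order
system `Δ = 0`: the derivative of `Δ` along the second prolongation of `V` vanishes at each jet over
`Ω` on which `Δ` vanishes. Each jet is the jet of some smooth `f`. -/
def IsLieSymmetry {G : Type*} [NormedAddCommGroup G] [NormedSpace ℝ G] (Δ : Jet → G)
    (Ω : Set Total) (V : Total → Total) : Prop :=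
  ContDiffOn ℝ ∞ V Ω ∧
    ∀ f : Base → Fib, ContDiff ℝ ∞ f → ∀ p : Base, (p, f p) ∈ Ω →
      Δ (jet f p) = 0 → fderiv ℝ Δ (jet f p) (prolongation V f p) = 0

/-- The complex number `u + i v`. -/
def toC (r : Fib) : ℂ := ⟨r 0, r 1⟩

/-- The original system for `ψ`, `φ` as functions of `(x, y, t)`. -/
def SolvesOriginal (a b c ε₀ d m w : ℝ) (ψ : Base → ℂ) (φ : Base → ℝ) : Prop :=
  ∀ p : Base,
    Complex.I * pd 2 ψ p + a * pd 0 (pd 0 ψ) p + ε₀ * pd 1 (pd 1 ψ) p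
      = (b - w * m) * (‖ψ p‖ ^ 2 : ℝ) * ψ p
        - w * ψ p * ((m * pd 2 φ p + (m * c - d) * pd 1 φ p : ℝ) : ℂ) ∧
    pd 0 (pd 0 φ) p + (1 - m * c ^ 2) * pd 1 (pd 1 φ) p - m * pd 2 (pd 2 φ) p
        - 2 * m * c * pd 2 (pd 1 φ) p
      = m * pd 2 (fun q => ‖ψ q‖ ^ 2) p + (m * c - d) * pd 1 (fun q => ‖ψ q‖ ^ 2) p

/-- The linear change of variables: the old variables `(x, y, t)` as functions of the new ones
`(x, ξ, η)`, `y = (mc - d) ξ + √m (cd - 1) η`, `t = m ξ + d √m η`. -/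
def change (c d m : ℝ) (q : Base) : Base :=
  ![q 0, (m * c - d) * q 1 + √m * (c * d - 1) * q 2, m * q 1 + d * √m * q 2]

/-- The new unknowns `(Re ψ, Im ψ, ∂φ/∂ξ)` as functions of `(x, ξ, η)`. -/
def transform (c d m : ℝ) (ψ : Base → ℂ) (φ : Base → ℝ) : Base → Fib :=
  fun q => ![(ψ (change c d m q)).re, (ψ (change c d m q)).im,
    pd 1 (fun r => φ (change c d m r)) q]

/-- The left-hand side minus the right-hand side of the first equation of the transformed system,
where the new variables `(ξ, η)` are again called `(y, t)`. -/
def eqA (a b c ε₀ d m w : ℝ) (J : Jet) : ℂ :=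
  let a₁ : ℝ := (d - m * c) / ((d ^ 2 - m) * √m)
  let a₂ : ℝ := ε₀ * d ^ 2 / (d ^ 2 - m) ^ 2
  let a₃ : ℝ := ε₀ * m / (d ^ 2 - m) ^ 2
  let a₄ : ℝ := -(2 * ε₀ * d * √m) / (d ^ 2 - m) ^ 2
  let a₅ : ℝ := (d * c - 1) / (d ^ 2 - m)
  let ψ : ℂ := toC J.2.1
  let φ : ℝ := J.2.1 2
  let ψy : ℂ := toC (J.2.2.1 1)
  let ψt : ℂ := toC (J.2.2.1 2)
  let ψxx : ℂ := toC (J.2.2.2 0 0)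
  let ψyy : ℂ := toC (J.2.2.2 1 1)
  let ψtt : ℂ := toC (J.2.2.2 2 2)
  let ψty : ℂ := toC (J.2.2.2 2 1)
  Complex.I * a₁ * ψt + a * ψxx + a₂ * ψyy + a₃ * ψtt + a₄ * ψty + Complex.I * a₅ * ψy
    - ((b - w * m) * (‖ψ‖ ^ 2 : ℝ) * ψ - w * ψ * φ)

/-- The left-hand side minus the right-hand side of the second equation of the transformed system,
`φ_xx + (φ_yy - φ_tt) / (d² - m) = (|ψ|²)_yy`, with
`(|ψ|²)_yy = 2 (u u_yy + v v_yy + u_y² + v_y²)`. -/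
def eqB (d m : ℝ) (J : Jet) : ℝ :=
  let u := J.2.1 0
  let v := J.2.1 1
  let uy := J.2.2.1 1 0
  let vy := J.2.2.1 1 1
  let uyy := J.2.2.2 1 1 0
  let vyy := J.2.2.2 1 1 1
  let φxx := J.2.2.2 0 0 2
  let φyy := J.2.2.2 1 1 2
  let φtt := J.2.2.2 2 2 2
  φxx + 1 / (d ^ 2 - m) * (φyy - φtt) - 2 * (u * uyy + v * vyy + uy ^ 2 + vy ^ 2)

/-- The transformed system, as a function on the second-order jets. -/
def system (a b c ε₀ d m w : ℝ) (J : Jet) : ℂ × ℝ :=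
  (eqA a b c ε₀ d m w J, eqB d m J)

/-- The phase rotation `-v ∂_u + u ∂_v`. -/
def rot (z : Total) : Total := (0, ![-z.2 1, z.2 0, 0])

/-- The coordinate field `∂_φ`. -/
def dφ (_ : Total) : Total := (0, ![0, 0, 1])

/-- The function `d t + √m y`. -/
def phase (d m : ℝ) (z : Total) : ℝ := d * z.1 2 + √m * z.1 1

/-- The six vector fields; `gen d m w i` is the field number `i + 1`. -/
def gen (d m w : ℝ) : Fin 6 → Total → Total :=
  ![fun _ => (Pi.single 2 1, 0),
    fun _ => (Pi.single 0 1, 0),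
    fun _ => (Pi.single 1 1, 0),
    rot,
    fun z => phase d m z • rot z + (1 / (w * √m)) • dφ z,
    fun z => phase d m z ^ 2 • rot z + (2 * phase d m z / (w * √m)) • dφ z]

end BRZR

end

noncomputable section
namespace BRZR
open Filter Topology

/-! ### Partial derivatives of functions composed with a graph. -/

section Calculus

variable {G : Type*} [NormedAddCommGroup G] [NormedSpace ℝ G]

/-! The second-order part of the first transformed equation in `(y, t)` is a perfect square, a
multiple of `(d ∂_y - √m ∂_t)²`, and `d ∂_y - √m ∂_t` annihilates functions of the phase `τ = d t +
√m y`. If `ψ` is multiplied by `exp (i A(τ))`, the second-order terms therefore contribute nothing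
new, the first-order terms contribute `-A'(τ) ψ / √m`, and adding `A'(τ) / (w √m)` to `φ`
compensates for that. The second equation sees only this shift, and `φ_yy - φ_tt` turns it into a
multiple of `(m - d²) A'''`; as `d² ≠ m`, `A` has to be quadratic. Together with the translations
this gives the six fields, collected in `symField` (`isSymmetry_symField`).

That there are no others is seen on jets. Every symmetric second-order jet is the jet of a quadratic
polynomial, so the symmetry condition is an identity in free jet coordinates
(`isLieSymmetry_system_iff`). As `a ≠ 0`, the equations can be solved for the second `x`-derivatives
(`Coeffs.particular`), and coefficients can be compared. Write `V = (ξ, η)`. The second derivatives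
(`IsSymmetry.top`) show that `ξ` depends on the base only and is conformal for the wave operator;
the first equation leaves only a dilation and translations. The first derivatives (`IsSymmetry.low`)
show that `η` is affine in the fibre; taken along the null covector `(√m, d)` they leave only the
drift term `a₁ d + a₅ √m`, which removes the dilation and gives Cauchy–Riemann equations. Hence the
`ψ`-component is `ψ (A + i B)` with `A`, `B` functions of `τ`. Jets without first derivatives then
give `A = 0`, `η^φ = B' / (w √m)` and `B''' = 0`.

For the change of variables, the point is that `∂_ξ` is the operator `m ∂_t + (mc - d) ∂_y` that
occurs in both original equations: `φ_ξ` is what the first equation contains, and the second is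
differentiated once in `ξ`. -/

theorem contDiff_pd {f : Base → G} (hf : ContDiff ℝ ∞ f) (i : Fin 3) : ContDiff ℝ ∞ (pd i f) := by
  unfold pd
  exact (hf.fderiv_right (m := ∞) (by simp)).clm_apply contDiff_const

theorem contDiffAt_pd {f : Base → G} {p : Base} (hf : ContDiffAt ℝ ∞ f p) (i : Fin 3) :
    ContDiffAt ℝ ∞ (pd i f) p := by
  unfold pd
  exact (hf.fderiv_right (m := ∞) (by simp)).clm_apply contDiffAt_const

theorem pd_congr {f g : Base → G} {p : Base} (h : f =ᶠ[𝓝 p] g) (i : Fin 3) :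
    pd i f p = pd i g p := by
  simp only [pd, h.fderiv_eq]

theorem pd_comm {f : Base → G} {p : Base} (hf : ContDiffAt ℝ ∞ f p) (i j : Fin 3) :
    pd i (pd j f) p = pd j (pd i f) p := by
  have hd : DifferentiableAt ℝ (fderiv ℝ f) p :=
    (hf.fderiv_right (m := ∞) (by simp)).differentiableAt (by simp)
  have hs : IsSymmSndFDerivAt ℝ f p := hf.isSymmSndFDerivAt (by simpa using ENat.LEInfty.out)
  have key : ∀ i j : Fin 3, pd i (pd j f) p
      = fderiv ℝ (fderiv ℝ f) p (Pi.single i 1) (Pi.single j 1) := by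
    intro i j
    have := hd.hasFDerivAt.clm_apply (hasFDerivAt_const (Pi.single j (1 : ℝ) : Base) p)
    change fderiv ℝ (fun q => fderiv ℝ f q (Pi.single j 1)) p (Pi.single i 1) = _
    rw [this.fderiv]
    simp
  rw [key, key, hs]

theorem pd_sub {f g : Base → G} {p : Base} (hf : DifferentiableAt ℝ f p)
    (hg : DifferentiableAt ℝ g p) (i : Fin 3) :
    pd i (fun q => f q - g q) p = pd i f p - pd i g p := by
  simp only [pd]
  rw [fderiv_fun_sub hf hg]
  rfl

theorem pd_sum_smul {X : Base → Base} {g : Fin 3 → Base → G} {p : Base}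
    (hX : DifferentiableAt ℝ X p) (hg : ∀ k, DifferentiableAt ℝ (g k) p) (i : Fin 3) :
    pd i (fun q => ∑ k, X q k • g k q) p
      = ∑ k, pd i X p k • g k p + ∑ k, X p k • pd i (g k) p := by
  have hXk : ∀ k, HasFDerivAt (fun q => X q k)
      ((ContinuousLinearMap.proj (R := ℝ) (φ := fun _ : Fin 3 => ℝ) k).comp (fderiv ℝ X p)) p :=
    fun k => (hasFDerivAt_pi'.1 hX.hasFDerivAt) k
  have := HasFDerivAt.fun_sum (u := Finset.univ)
    (fun k _ => (hXk k).smul (hg k).hasFDerivAt)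
  simp only [pd]
  erw [this.fderiv]
  simp [Finset.sum_add_distrib, add_comm]

theorem pd_add {f g : Base → G} {p : Base} (hf : DifferentiableAt ℝ f p)
    (hg : DifferentiableAt ℝ g p) (i : Fin 3) :
    pd i (fun q => f q + g q) p = pd i f p + pd i g p := by
  simp only [pd]
  rw [fderiv_fun_add hf hg]
  rfl

theorem pd_fst {F : Base → Total} {p : Base} (hF : DifferentiableAt ℝ F p) (i : Fin 3) :
    pd i (fun q => (F q).1) p = (pd i F p).1 := by
  simp only [pd]
  rw [hF.hasFDerivAt.fst.fderiv]
  rfl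

theorem pd_snd {F : Base → Total} {p : Base} (hF : DifferentiableAt ℝ F p) (i : Fin 3) :
    pd i (fun q => (F q).2) p = (pd i F p).2 := by
  simp only [pd]
  rw [hF.hasFDerivAt.snd.fderiv]
  rfl

theorem pd_graph {W : Total → G} {f : Base → Fib} {p : Base}
    (hW : DifferentiableAt ℝ W (p, f p)) (hf : DifferentiableAt ℝ f p) (i : Fin 3) :
    pd i (fun q => W (q, f q)) p = fderiv ℝ W (p, f p) (Pi.single i 1, pd i f p) := by
  have h1 : HasFDerivAt (fun q => (q, f q)) _ p := (hasFDerivAt_id p).prodMk hf.hasFDerivAt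
  have := HasFDerivAt.comp p (g := W) (f := fun q => (q, f q)) hW.hasFDerivAt h1
  simp only [pd]
  erw [this.fderiv]
  simp

theorem pd_pd_graph {W : Total → G} {f : Base → Fib} {p : Base}
    (hW : ContDiffAt ℝ ∞ W (p, f p)) (hf : ContDiff ℝ ∞ f) (i j : Fin 3) :
    pd i (pd j (fun q => W (q, f q))) p
      = fderiv ℝ (fderiv ℝ W) (p, f p) (Pi.single i 1, pd i f p) (Pi.single j 1, pd j f p)
        + fderiv ℝ W (p, f p) (0, pd i (pd j f) p) := by
  have hcont : ContinuousAt (fun q => (q, f q)) p :=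
    (continuous_id.prodMk hf.continuous).continuousAt
  have hev : pd j (fun q => W (q, f q))
      =ᶠ[𝓝 p] fun q => fderiv ℝ W (q, f q) (Pi.single j 1, pd j f q) := by
    have := (hW.of_le (m := 1) (by simp)).eventually (by simp)
    filter_upwards [hcont.eventually this] with q hq
    exact pd_graph (hq.differentiableAt (by simp)) (hf.differentiable (by simp) q) j
  rw [pd_congr hev]
  have h1 : HasFDerivAt (fun q => (q, f q)) _ p :=
    (hasFDerivAt_id p).prodMk (hf.differentiable (by simp) p).hasFDerivAt
  have hd : DifferentiableAt ℝ (fderiv ℝ W) (p, f p) :=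
    (hW.fderiv_right (m := ∞) (by simp)).differentiableAt (by simp)
  have h2 := HasFDerivAt.comp p (g := fderiv ℝ W) (f := fun q => (q, f q)) hd.hasFDerivAt h1
  have h3 : HasFDerivAt (fun q => ((Pi.single j 1 : Base), pd j f q)) _ p :=
    (hasFDerivAt_const (Pi.single j 1 : Base) p).prodMk
      ((contDiff_pd hf j).differentiable (by simp) p).hasFDerivAt
  have h4 := h2.clm_apply h3
  change fderiv ℝ _ p _ = _
  erw [h4.fderiv]
  simp [pd, add_comm]

end Calculus

/-! ### The prolongation as a function of the second-order jet. -/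

/-- The second prolongation of `V` at the jet `(z, f₁, f₂)`, in terms of the first two derivatives
of `V`. -/
def prolongationAt (V : Total → Total) (z : Total) (f₁ : Fin 3 → Fib)
    (f₂ : Fin 3 → Fin 3 → Fib) : Jet :=
  ((V z).1, (V z).2,
    fun i => (fderiv ℝ V z (Pi.single i 1, f₁ i)).2
      - ∑ k, (fderiv ℝ V z (Pi.single i 1, f₁ i)).1 k • f₁ k,
    fun i j => (fderiv ℝ (fderiv ℝ V) z (Pi.single i 1, f₁ i) (Pi.single j 1, f₁ j)
        + fderiv ℝ V z (0, f₂ i j)).2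
      - ∑ k, (fderiv ℝ (fderiv ℝ V) z (Pi.single i 1, f₁ i) (Pi.single j 1, f₁ j)
        + fderiv ℝ V z (0, f₂ i j)).1 k • f₁ k
      - ∑ k, (fderiv ℝ V z (Pi.single j 1, f₁ j)).1 k • f₂ i k
      - ∑ k, (fderiv ℝ V z (Pi.single i 1, f₁ i)).1 k • f₂ j k)

/-- `D_J Q` contains `-∑ ξ^k ∂_J ∂ₖ f`; since partial derivatives commute, this is what the
prolongation adds back, and only derivatives of `f` of order at most two remain. -/
theorem prolongation_eq {V : Total → Total} {f : Base → Fib} {p : Base}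
    (hV : ContDiffAt ℝ ∞ V (p, f p)) (hf : ContDiff ℝ ∞ f) :
    prolongation V f p
      = prolongationAt V (p, f p) (fun i => pd i f p) (fun i j => pd i (pd j f) p) := by
  set F : Base → Total := fun q => V (q, f q) with hF
  have hFs : ContDiffAt ℝ ∞ F p :=
    ContDiffAt.comp p (g := V) (f := fun q => (q, f q)) hV (contDiff_id.prodMk hf).contDiffAt
  have hFd : ∀ᶠ q in 𝓝 p, DifferentiableAt ℝ F q := by
    have := (hFs.of_le (m := 1) (by simp)).eventually (by simp)
    filter_upwards [this] with q hq
    exact hq.differentiableAt (by simp)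
  have hg : ∀ k q, DifferentiableAt ℝ (pd k f) q :=
    fun k q => (contDiff_pd hf k).differentiable (by simp) q
  have hgg : ∀ i k q, DifferentiableAt ℝ (pd i (pd k f)) q :=
    fun i k q => (contDiff_pd (contDiff_pd hf k) i).differentiable (by simp) q
  have h1 : ∀ q, DifferentiableAt ℝ F q → ∀ i, pd i (characteristic V f) q
      = (pd i F q).2 - (∑ k, (pd i F q).1 k • pd k f q + ∑ k, (F q).1 k • pd i (pd k f) q) := by
    intro q hq i
    have hX : DifferentiableAt ℝ (fun q => (F q).1) q := hq.fst
    have hY : DifferentiableAt ℝ (fun q => (F q).2) q := hq.snd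
    have hS : DifferentiableAt ℝ (fun q => ∑ k, (F q).1 k • pd k f q) q := by
      refine DifferentiableAt.fun_sum fun k _ => ?_
      exact (differentiableAt_pi.1 hX k).smul (hg k q)
    change pd i (fun q => (F q).2 - ∑ k, (F q).1 k • pd k f q) q = _
    rw [pd_sub hY hS, pd_sum_smul hX (fun k => hg k q),
      pd_fst hq, pd_snd hq]
  have hFp : DifferentiableAt ℝ F p := hFd.self_of_nhds
  have hpF : ∀ j, DifferentiableAt ℝ (pd j F) p :=
    fun j => (contDiffAt_pd hFs j).differentiableAt (by simp)
  have h2 : ∀ i j, pd i (pd j (characteristic V f)) p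
      = (pd i (pd j F) p).2
        - (∑ k, (pd i (pd j F) p).1 k • pd k f p + ∑ k, (pd j F p).1 k • pd i (pd k f) p
          + (∑ k, (pd i F p).1 k • pd j (pd k f) p
            + ∑ k, (F p).1 k • pd i (pd j (pd k f)) p)) := by
    intro i j
    -- `V` is smooth only near `(p, f p)`, so the formula for the first derivatives holds only near
    -- `p`; that suffices to differentiate it again.
    have hev : pd j (characteristic V f) =ᶠ[𝓝 p] fun q => (pd j F q).2
        - (∑ k, (pd j F q).1 k • pd k f q + ∑ k, (F q).1 k • pd j (pd k f) q) := by
      filter_upwards [hFd] with q hq using h1 q hq j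
    have hX : DifferentiableAt ℝ (fun q => (F q).1) p := hFp.fst
    have hX' : DifferentiableAt ℝ (fun q => (pd j F q).1) p := (hpF j).fst
    have hY' : DifferentiableAt ℝ (fun q => (pd j F q).2) p := (hpF j).snd
    have hS : DifferentiableAt ℝ (fun q => ∑ k, (pd j F q).1 k • pd k f q) p := by
      refine DifferentiableAt.fun_sum fun k _ => ?_
      exact (differentiableAt_pi.1 hX' k).smul (hg k p)
    have hS' : DifferentiableAt ℝ (fun q => ∑ k, (F q).1 k • pd j (pd k f) q) p := by
      refine DifferentiableAt.fun_sum fun k _ => ?_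
      exact (differentiableAt_pi.1 hX k).smul (hgg j k p)
    rw [pd_congr hev, pd_sub hY' (hS.fun_add hS'), pd_add hS hS', pd_sum_smul hX' (fun k => hg k p),
      pd_sum_smul hX (fun k => hgg j k p),
      pd_fst (hpF j), pd_snd (hpF j), pd_fst hFp]
  have h3 : ∀ i, pd i F p = fderiv ℝ V (p, f p) (Pi.single i 1, pd i f p) :=
    fun i => pd_graph (hV.differentiableAt (by simp)) (hf.differentiable (by simp) p) i
  have h4 := fun i j => pd_pd_graph hV hf i j
  have hc : ∀ q i j, pd i (pd j f) q = pd j (pd i f) q := fun q i j => pd_comm hf.contDiffAt i j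
  unfold prolongation prolongationAt
  congr 3
  · funext i
    rw [h1 p hFp i, h3]
    simp only [hc p i, sub_add, add_sub_cancel_right, hF]
  · funext i j
    rw [h2, h4, h3, h3]
    have : ∀ k, pd i (pd j (pd k f)) p = pd k (pd i (pd j f)) p := by
      intro k
      have e : pd j (pd k f) = pd k (pd j f) := funext fun q => hc q j k
      rw [e, pd_comm (contDiff_pd hf j).contDiffAt]
    simp only [this, hF]
    abel

/-! ### Polynomials with a prescribed second-order jet. -/

/-- The quadratic polynomial with value `r`, first derivatives `f₁` and second derivatives `f₂`
at `p`. -/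
def taylor (p : Base) (r : Fib) (f₁ : Fin 3 → Fib) (f₂ : Fin 3 → Fin 3 → Fib) (q : Base) : Fib :=
  r + ∑ i, (q i - p i) • f₁ i + (1 / 2 : ℝ) • ∑ i, ∑ j, ((q i - p i) * (q j - p j)) • f₂ i j

theorem contDiff_taylor (p : Base) (r : Fib) (f₁ : Fin 3 → Fib) (f₂ : Fin 3 → Fin 3 → Fib) :
    ContDiff ℝ ∞ (taylor p r f₁ f₂) := by
  unfold taylor
  fun_prop

theorem hasFDerivAt_coord (p : Base) (i : Fin 3) (q : Base) :
    HasFDerivAt (fun q : Base => q i - p i)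
      (ContinuousLinearMap.proj (R := ℝ) (φ := fun _ : Fin 3 => ℝ) i) q :=
  (hasFDerivAt_apply i q).sub_const (p i)

theorem pd_taylor (p : Base) (r : Fib) (f₁ : Fin 3 → Fib) (f₂ : Fin 3 → Fin 3 → Fib)
    (hs : ∀ i j, f₂ i j = f₂ j i) (i : Fin 3) :
    pd i (taylor p r f₁ f₂) = fun q => f₁ i + ∑ j, (q j - p j) • f₂ i j := by
  funext q
  have h1 := HasFDerivAt.fun_sum (u := Finset.univ)
    (fun k _ => (hasFDerivAt_coord p k q).smul_const (f₁ k))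
  have h2 := HasFDerivAt.fun_sum (u := Finset.univ) (fun k _ =>
    HasFDerivAt.fun_sum (u := Finset.univ)
    (fun l _ => ((hasFDerivAt_coord p k q).mul (hasFDerivAt_coord p l q)).smul_const (f₂ k l)))
  have h3 := (h1.const_add r).add (h2.const_smul (1 / 2 : ℝ))
  simp only [pd]
  erw [h3.fderiv]
  simp only [Fin.sum_univ_three]
  fin_cases i <;> ext k <;> simp [hs 1 0, hs 2 0, hs 2 1] <;> ring

/-- Nothing but the symmetry of the second derivatives constrains a jet, so in the symmetry
condition the derivatives of `f` may be chosen freely. -/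
theorem jet_taylor (p : Base) (r : Fib) (f₁ : Fin 3 → Fib) (f₂ : Fin 3 → Fin 3 → Fib)
    (hs : ∀ i j, f₂ i j = f₂ j i) : jet (taylor p r f₁ f₂) p = (p, r, f₁, f₂) := by
  have h1 : taylor p r f₁ f₂ p = r := by simp [taylor]
  have h2 : ∀ i, pd i (taylor p r f₁ f₂) p = f₁ i := by
    intro i
    rw [pd_taylor p r f₁ f₂ hs]
    simp
  have h3 : ∀ i j, pd i (pd j (taylor p r f₁ f₂)) p = f₂ i j := by
    intro i j
    rw [pd_taylor p r f₁ f₂ hs]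
    have h := (HasFDerivAt.fun_sum (u := Finset.univ)
      (fun k _ => (hasFDerivAt_coord p k p).smul_const (f₂ j k))).const_add (f₁ j)
    simp only [pd]
    erw [h.fderiv]
    rw [hs i j]
    fin_cases i <;> simp [Fin.sum_univ_three]
  simp only [jet, h1, h2, h3]

/-! ### The system with general coefficients and its linearisation. -/

/-- The coefficients of a system `i a₁ ψ_t + a ψ_xx + a₂ ψ_yy + a₃ ψ_tt + a₄ ψ_ty + i a₅ ψ_y
= κ |ψ|² ψ - w ψ φ`, `φ_xx + σ (φ_yy - φ_tt) = (|ψ|²)_yy`. -/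
structure Coeffs where
  (a a₁ a₂ a₃ a₄ a₅ κ σ w : ℝ)

namespace Coeffs

variable (K : Coeffs)

/-- The second-order part of the first equation. -/
def opP (s : Fin 3 → Fin 3 → Fib) (α : Fin 3) : ℝ :=
  K.a * s 0 0 α + K.a₂ * s 1 1 α + K.a₃ * s 2 2 α + K.a₄ * s 2 1 α

/-- The first-order part of the first equation, without the factor `i`. -/
def opQ (s : Fin 3 → Fib) (α : Fin 3) : ℝ := K.a₁ * s 2 α + K.a₅ * s 1 α

/-- The real part of the first equation. -/
def eqRe (J : Jet) : ℝ :=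
  K.opP J.2.2.2 0 - K.opQ J.2.2.1 1 - K.κ * (J.2.1 0 ^ 2 + J.2.1 1 ^ 2) * J.2.1 0
    + K.w * J.2.1 0 * J.2.1 2

/-- The imaginary part of the first equation. -/
def eqIm (J : Jet) : ℝ :=
  K.opP J.2.2.2 1 + K.opQ J.2.2.1 0 - K.κ * (J.2.1 0 ^ 2 + J.2.1 1 ^ 2) * J.2.1 1
    + K.w * J.2.1 1 * J.2.1 2

/-- The second equation. -/
def eqWave (J : Jet) : ℝ :=
  J.2.2.2 0 0 2 + K.σ * (J.2.2.2 1 1 2 - J.2.2.2 2 2 2)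
    - 2 * (J.2.1 0 * J.2.2.2 1 1 0 + J.2.1 1 * J.2.2.2 1 1 1 + J.2.2.1 1 0 ^ 2 + J.2.2.1 1 1 ^ 2)

/-- The derivative of `eqRe` at `J` along `P`. -/
def linRe (J P : Jet) : ℝ :=
  K.opP P.2.2.2 0 - K.opQ P.2.2.1 1
    - K.κ * (2 * (J.2.1 0 * P.2.1 0 + J.2.1 1 * P.2.1 1) * J.2.1 0
      + (J.2.1 0 ^ 2 + J.2.1 1 ^ 2) * P.2.1 0)
    + K.w * (P.2.1 0 * J.2.1 2 + J.2.1 0 * P.2.1 2)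

/-- The derivative of `eqIm` at `J` along `P`. -/
def linIm (J P : Jet) : ℝ :=
  K.opP P.2.2.2 1 + K.opQ P.2.2.1 0
    - K.κ * (2 * (J.2.1 0 * P.2.1 0 + J.2.1 1 * P.2.1 1) * J.2.1 1
      + (J.2.1 0 ^ 2 + J.2.1 1 ^ 2) * P.2.1 1)
    + K.w * (P.2.1 1 * J.2.1 2 + J.2.1 1 * P.2.1 2)

/-- The derivative of `eqWave` at `J` along `P`. -/
def linWave (J P : Jet) : ℝ :=
  P.2.2.2 0 0 2 + K.σ * (P.2.2.2 1 1 2 - P.2.2.2 2 2 2)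
    - 2 * (P.2.1 0 * J.2.2.2 1 1 0 + J.2.1 0 * P.2.2.2 1 1 0
      + P.2.1 1 * J.2.2.2 1 1 1 + J.2.1 1 * P.2.2.2 1 1 1
      + 2 * J.2.2.1 1 0 * P.2.2.1 1 0 + 2 * J.2.2.1 1 1 * P.2.2.1 1 1)

theorem differentiable_eqRe : Differentiable ℝ K.eqRe := by
  unfold eqRe opP opQ
  fun_prop

theorem differentiable_eqIm : Differentiable ℝ K.eqIm := by
  unfold eqIm opP opQ
  fun_prop

theorem differentiable_eqWave : Differentiable ℝ K.eqWave := by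
  unfold eqWave
  fun_prop

end Coeffs

/-- The equations are polynomials of degree at most three in the jet, so their derivative along `P`
is the coefficient of `s` on the line `J + s P`. -/
theorem fderiv_eq_of_line {E : Type*} [NormedAddCommGroup E] [NormedSpace ℝ E] {f : E → ℝ}
    {x v : E} {d : ℝ} (hf : DifferentiableAt ℝ f x)
    (h : HasDerivAt (fun s : ℝ => f (x + s • v)) d 0) : fderiv ℝ f x v = d := by
  rw [← hf.lineDeriv_eq_fderiv]
  exact h.deriv

/-- A polynomial of degree three in one variable has the expected derivative at zero. -/
theorem hasDerivAt_cubic {g : ℝ → ℝ} (c₀ c₁ c₂ c₃ : ℝ)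
    (h : ∀ s, g s = c₀ + s * c₁ + s ^ 2 * c₂ + s ^ 3 * c₃) : HasDerivAt g c₁ 0 := by
  have e : g = fun s => c₀ + s * c₁ + s ^ 2 * c₂ + s ^ 3 * c₃ := funext h
  rw [e]
  have := ((((hasDerivAt_id (0 : ℝ)).mul_const c₁).const_add c₀).add
    ((hasDerivAt_pow 2 (0 : ℝ)).mul_const c₂)).add ((hasDerivAt_pow 3 (0 : ℝ)).mul_const c₃)
  refine this.congr_deriv ?_
  norm_num

namespace Coeffs

variable (K : Coeffs)

theorem fderiv_eqRe (J P : Jet) : fderiv ℝ K.eqRe J P = K.linRe J P := by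
  refine fderiv_eq_of_line (K.differentiable_eqRe J) ?_
  refine hasDerivAt_cubic (K.eqRe J) _
    (-K.κ * ((P.2.1 0 ^ 2 + P.2.1 1 ^ 2) * J.2.1 0
      + 2 * (J.2.1 0 * P.2.1 0 + J.2.1 1 * P.2.1 1) * P.2.1 0) + K.w * P.2.1 0 * P.2.1 2)
    (-K.κ * (P.2.1 0 ^ 2 + P.2.1 1 ^ 2) * P.2.1 0) fun s => ?_
  simp only [eqRe, linRe, opP, opQ, Prod.fst_add, Prod.snd_add, Prod.smul_fst, Prod.smul_snd,
    Pi.add_apply, Pi.smul_apply, smul_eq_mul]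
  ring

theorem fderiv_eqIm (J P : Jet) : fderiv ℝ K.eqIm J P = K.linIm J P := by
  refine fderiv_eq_of_line (K.differentiable_eqIm J) ?_
  refine hasDerivAt_cubic (K.eqIm J) _
    (-K.κ * ((P.2.1 0 ^ 2 + P.2.1 1 ^ 2) * J.2.1 1
      + 2 * (J.2.1 0 * P.2.1 0 + J.2.1 1 * P.2.1 1) * P.2.1 1) + K.w * P.2.1 1 * P.2.1 2)
    (-K.κ * (P.2.1 0 ^ 2 + P.2.1 1 ^ 2) * P.2.1 1) fun s => ?_
  simp only [eqIm, linIm, opP, opQ, Prod.fst_add, Prod.snd_add, Prod.smul_fst, Prod.smul_snd,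
    Pi.add_apply, Pi.smul_apply, smul_eq_mul]
  ring

theorem fderiv_eqWave (J P : Jet) : fderiv ℝ K.eqWave J P = K.linWave J P := by
  refine fderiv_eq_of_line (K.differentiable_eqWave J) ?_
  refine hasDerivAt_cubic (K.eqWave J) _
    (-2 * (P.2.1 0 * P.2.2.2 1 1 0 + P.2.1 1 * P.2.2.2 1 1 1
      + P.2.2.1 1 0 ^ 2 + P.2.2.1 1 1 ^ 2)) 0 fun s => ?_
  simp only [eqWave, linWave, Prod.fst_add, Prod.snd_add, Prod.smul_fst, Prod.smul_snd,
    Pi.add_apply, Pi.smul_apply, smul_eq_mul]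
  ring

end Coeffs

/-! ### The symmetry condition in terms of free jets. -/

/-- The coefficients of the transformed system. -/
def coeffs (a b c ε₀ d m w : ℝ) : Coeffs where
  a := a
  a₁ := (d - m * c) / ((d ^ 2 - m) * √m)
  a₂ := ε₀ * d ^ 2 / (d ^ 2 - m) ^ 2
  a₃ := ε₀ * m / (d ^ 2 - m) ^ 2
  a₄ := -(2 * ε₀ * d * √m) / (d ^ 2 - m) ^ 2
  a₅ := (d * c - 1) / (d ^ 2 - m)
  κ := b - w * m
  σ := 1 / (d ^ 2 - m)
  w := w

section System

variable (a b c ε₀ d m w : ℝ)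

theorem system_eq_prod (J : Jet) : system a b c ε₀ d m w J
    = (Complex.equivRealProdCLM.symm
      ((coeffs a b c ε₀ d m w).eqRe J, (coeffs a b c ε₀ d m w).eqIm J),
      (coeffs a b c ε₀ d m w).eqWave J) := by
  have hn : ‖toC J.2.1‖ ^ 2 = J.2.1 0 ^ 2 + J.2.1 1 ^ 2 := by
    rw [← Complex.normSq_eq_norm_sq, Complex.normSq_apply]
    simp only [toC]
    ring
  refine Prod.ext ?_ ?_
  · simp only [system, eqA, hn]
    apply Complex.ext
    -- Each real coefficient is kept as one cast, so that its imaginary part simplifies to zero.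
    · simp [toC, Coeffs.eqRe, Coeffs.opP, Coeffs.opQ, coeffs, -Complex.ofReal_div,
        -Complex.ofReal_mul, -Complex.ofReal_neg, -Complex.ofReal_pow, -Complex.ofReal_add,
        -Complex.ofReal_sub]
      ring
    · simp [toC, Coeffs.eqIm, Coeffs.opP, Coeffs.opQ, coeffs, -Complex.ofReal_div,
        -Complex.ofReal_mul, -Complex.ofReal_neg, -Complex.ofReal_pow, -Complex.ofReal_add,
        -Complex.ofReal_sub]
      ring
  · rfl

theorem system_eq_zero_iff (J : Jet) : system a b c ε₀ d m w J = 0 ↔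
    (coeffs a b c ε₀ d m w).eqRe J = 0 ∧ (coeffs a b c ε₀ d m w).eqIm J = 0
      ∧ (coeffs a b c ε₀ d m w).eqWave J = 0 := by
  rw [system_eq_prod, Prod.mk_eq_zero, map_eq_zero_iff _ (ContinuousLinearEquiv.injective _),
    Prod.mk_eq_zero, and_assoc]

theorem fderiv_system_eq_zero_iff (J P : Jet) : fderiv ℝ (system a b c ε₀ d m w) J P = 0 ↔
    (coeffs a b c ε₀ d m w).linRe J P = 0 ∧ (coeffs a b c ε₀ d m w).linIm J P = 0
      ∧ (coeffs a b c ε₀ d m w).linWave J P = 0 := by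
  set K := coeffs a b c ε₀ d m w
  have h : HasFDerivAt (system a b c ε₀ d m w)
      (((Complex.equivRealProdCLM.symm : ℝ × ℝ →L[ℝ] ℂ).comp
        ((fderiv ℝ K.eqRe J).prod (fderiv ℝ K.eqIm J))).prod (fderiv ℝ K.eqWave J)) J := by
    have e : system a b c ε₀ d m w
        = fun J => (Complex.equivRealProdCLM.symm (K.eqRe J, K.eqIm J), K.eqWave J) :=
      funext (system_eq_prod a b c ε₀ d m w)
    rw [e]
    exact ((Complex.equivRealProdCLM.symm : ℝ × ℝ →L[ℝ] ℂ).hasFDerivAt.comp J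
      ((K.differentiable_eqRe J).hasFDerivAt.prodMk (K.differentiable_eqIm J).hasFDerivAt)).prodMk
      (K.differentiable_eqWave J).hasFDerivAt
  rw [h.fderiv, ← K.fderiv_eqRe, ← K.fderiv_eqIm, ← K.fderiv_eqWave]
  rw [ContinuousLinearMap.prod_apply, Prod.mk_eq_zero, ContinuousLinearMap.comp_apply]
  erw [map_eq_zero_iff _ (ContinuousLinearEquiv.injective _)]
  rw [ContinuousLinearMap.prod_apply, Prod.mk_eq_zero, and_assoc]

/-- The field `V` is smooth on `Ω` and its prolongation annihilates the real equations at all jets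
over `Ω` that satisfy them. -/
def Coeffs.IsSymmetry (K : Coeffs) (Ω : Set Total) (V : Total → Total) : Prop :=
  ContDiffOn ℝ ∞ V Ω ∧
    ∀ z ∈ Ω, ∀ (f₁ : Fin 3 → Fib) (f₂ : Fin 3 → Fin 3 → Fib), (∀ i j, f₂ i j = f₂ j i) →
      K.eqRe (z.1, z.2, f₁, f₂) = 0 → K.eqIm (z.1, z.2, f₁, f₂) = 0 →
      K.eqWave (z.1, z.2, f₁, f₂) = 0 →
        K.linRe (z.1, z.2, f₁, f₂) (prolongationAt V z f₁ f₂) = 0 ∧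
        K.linIm (z.1, z.2, f₁, f₂) (prolongationAt V z f₁ f₂) = 0 ∧
        K.linWave (z.1, z.2, f₁, f₂) (prolongationAt V z f₁ f₂) = 0

/-- A smooth vector field is a symmetry exactly if its prolongation annihilates the real equations
at all their second-order jets. -/
theorem isLieSymmetry_system_iff {Ω : Set Total} (hΩ : IsOpen Ω) (V : Total → Total) :
    IsLieSymmetry (system a b c ε₀ d m w) Ω V
      ↔ (coeffs a b c ε₀ d m w).IsSymmetry Ω V := by
  unfold IsLieSymmetry Coeffs.IsSymmetry
  refine and_congr_right fun hV => ⟨fun h => ?_, fun h => ?_⟩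
  · rintro ⟨p, r⟩ hz f₁ f₂ hs h1 h2 h3
    -- The Taylor polynomial realises the given jet and serves as test function.
    have hj := jet_taylor p r f₁ f₂ hs
    have hv : taylor p r f₁ f₂ p = r := congrArg (fun J : Jet => J.2.1) hj
    have hf := contDiff_taylor p r f₁ f₂
    have := h _ hf p (by rwa [hv]) (by
      rw [hj, system_eq_zero_iff]
      exact ⟨h1, h2, h3⟩)
    rw [fderiv_system_eq_zero_iff, prolongation_eq
      (by rw [hv]; exact hV.contDiffAt (hΩ.mem_nhds hz)) hf, hj] at this
    have e1 : (fun i => pd i (taylor p r f₁ f₂) p) = f₁ :=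
      congrArg (fun J : Jet => J.2.2.1) hj
    have e2 : (fun i j => pd i (pd j (taylor p r f₁ f₂)) p) = f₂ :=
      congrArg (fun J : Jet => J.2.2.2) hj
    rwa [e1, e2, hv] at this
  · intro f hf p hp h0
    rw [system_eq_zero_iff] at h0
    rw [fderiv_system_eq_zero_iff, prolongation_eq (hV.contDiffAt (hΩ.mem_nhds hp)) hf]
    exact h (p, f p) hp (fun i => pd i f p) (fun i j => pd i (pd j f) p)
      (fun i j => pd_comm hf.contDiffAt i j) h0.1 h0.2.1 h0.2.2

end System

/-! ### Components of the field and the splitting of its prolongation. -/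

/-- The component of `V` along the `k`-th independent variable. -/
def baseComp (V : Total → Total) (k : Fin 3) (z : Total) : ℝ := (V z).1 k

/-- The component of `V` along the `α`-th dependent variable. -/
def fibComp (V : Total → Total) (α : Fin 3) (z : Total) : ℝ := (V z).2 α

/-- The coordinate vector of the `i`-th independent variable. -/
def baseVec (i : Fin 3) : Total := (Pi.single i 1, 0)

/-- The coordinate vector of the `α`-th dependent variable. -/
def fibVec (α : Fin 3) : Total := (0, Pi.single α 1)

theorem fib_eq_sum (r : Fib) : ((0, r) : Total) = ∑ α, r α • fibVec α := by
  refine Prod.ext ?_ ?_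
  · simp [fibVec, Fin.sum_univ_three]
  · ext k
    fin_cases k <;> simp [fibVec, Fin.sum_univ_three]

theorem base_eq_sum (r : Base) : ((r, 0) : Total) = ∑ α, r α • baseVec α := by
  refine Prod.ext ?_ ?_
  · ext k
    fin_cases k <;> simp [baseVec, Fin.sum_univ_three]
  · simp [baseVec, Fin.sum_univ_three]

theorem horizontal_eq_sum (i : Fin 3) (r : Fib) :
    ((Pi.single i 1, r) : Total) = baseVec i + ∑ α, r α • fibVec α := by
  rw [← fib_eq_sum]
  simp [baseVec]

section SecondDerivatives

variable {E G : Type*} [NormedAddCommGroup E] [NormedSpace ℝ E] [NormedAddCommGroup G]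
  [NormedSpace ℝ G]

theorem fderiv_fderiv_apply {W : E → G} {z : E} (hW : ContDiffAt ℝ ∞ W z) (a b : E) :
    fderiv ℝ (fderiv ℝ W) z a b = fderiv ℝ (fun y => fderiv ℝ W y b) z a := by
  have hd : DifferentiableAt ℝ (fderiv ℝ W) z :=
    (hW.fderiv_right (m := ∞) (by simp)).differentiableAt (by simp)
  rw [(hd.hasFDerivAt.clm_apply (hasFDerivAt_const b z)).fderiv]
  simp

theorem fderiv_fderiv_comm {W : E → G} {z : E} (hW : ContDiffAt ℝ ∞ W z) (a b : E) :
    fderiv ℝ (fderiv ℝ W) z a b = fderiv ℝ (fderiv ℝ W) z b a :=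
  hW.isSymmSndFDerivAt (by simpa using ENat.LEInfty.out) a b

theorem fderiv_clm_comp {G' : Type*} [NormedAddCommGroup G'] [NormedSpace ℝ G'] (L : G →L[ℝ] G')
    {W : E → G} {z : E} (hd : DifferentiableAt ℝ W z) (a : E) :
    fderiv ℝ (fun y => L (W y)) z a = L (fderiv ℝ W z a) := by
  have h : HasFDerivAt (fun y => L (W y)) (L.comp (fderiv ℝ W z)) z :=
    L.hasFDerivAt.comp z hd.hasFDerivAt
  rw [h.fderiv]
  rfl

theorem fderiv_fderiv_clm_comp {G' : Type*} [NormedAddCommGroup G'] [NormedSpace ℝ G']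
    (L : G →L[ℝ] G') {W : E → G} {z : E} (hW : ContDiffAt ℝ ∞ W z) (a b : E) :
    fderiv ℝ (fderiv ℝ (fun y => L (W y))) z a b = L (fderiv ℝ (fderiv ℝ W) z a b) := by
  have hL : ContDiffAt ℝ ∞ (fun y => L (W y)) z := L.contDiff.contDiffAt.comp z hW
  rw [fderiv_fderiv_apply hL, fderiv_fderiv_apply hW]
  have hc : ContDiffAt ℝ ∞ (fun y => fderiv ℝ W y b) z :=
    (hW.fderiv_right (m := ∞) (by simp)).clm_apply contDiffAt_const
  rw [← fderiv_clm_comp L (hc.differentiableAt (by simp))]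
  congr 1
  refine Filter.EventuallyEq.fderiv_eq ?_
  filter_upwards [(hW.of_le (m := 1) (by simp)).eventually (by simp)] with y hy
    using fderiv_clm_comp L (hy.differentiableAt (by simp)) b

variable {Ω : Set E}

theorem fderiv_congr_on (hΩ : IsOpen Ω) {f g : E → G} (h : ∀ z ∈ Ω, f z = g z) {z : E}
    (hz : z ∈ Ω) : fderiv ℝ f z = fderiv ℝ g z :=
  Filter.EventuallyEq.fderiv_eq (Filter.eventually_of_mem (hΩ.mem_nhds hz) h)

theorem fderiv_eq_zero_on (hΩ : IsOpen Ω) {f : E → G} (h : ∀ z ∈ Ω, f z = 0) {z : E}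
    (hz : z ∈ Ω) (a : E) : fderiv ℝ f z a = 0 := by
  rw [fderiv_congr_on hΩ h hz]
  simp

/-- Differentiating an identity between first derivatives. -/
theorem fderiv_fderiv_eq_of_fderiv_eq (hΩ : IsOpen Ω) {f : E → G} (hf : ContDiffOn ℝ ∞ f Ω)
    {b : E} {g : E → G} (h : ∀ z ∈ Ω, fderiv ℝ f z b = g z) {z : E} (hz : z ∈ Ω) (a : E) :
    fderiv ℝ (fderiv ℝ f) z a b = fderiv ℝ g z a := by
  rw [fderiv_fderiv_apply (hf.contDiffAt (hΩ.mem_nhds hz)), fderiv_congr_on hΩ h hz]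

theorem contDiffOn_fderiv_apply (hΩ : IsOpen Ω) {f : E → G} (hf : ContDiffOn ℝ ∞ f Ω) (b : E) :
    ContDiffOn ℝ ∞ (fun z => fderiv ℝ f z b) Ω :=
  (hf.fderiv_of_isOpen hΩ (m := ∞) (by simp)).clm_apply contDiffOn_const

theorem ContDiffOn.differentiableAt_of_isOpen (hΩ : IsOpen Ω) {f : E → G}
    (hf : ContDiffOn ℝ ∞ f Ω) {z : E} (hz : z ∈ Ω) : DifferentiableAt ℝ f z :=
  (hf.contDiffAt (hΩ.mem_nhds hz)).differentiableAt (by simp)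

end SecondDerivatives

/-- A continuous function that vanishes where the dependent variable number `α` does not vanish is
zero. -/
theorem eq_zero_of_fib_ne_zero {Ω : Set Total} (hΩ : IsOpen Ω) (α : Fin 3) {h : Total → ℝ}
    (hc : ContinuousOn h Ω) (h0 : ∀ z ∈ Ω, z.2 α ≠ 0 → h z = 0) : ∀ z ∈ Ω, h z = 0 := by
  intro z hz
  by_cases hzα : z.2 α = 0
  -- On the line through `z` in the direction `α` only the point `z` itself has vanishing
  -- coordinate, so `h z` is a limit of zeros.
  · have hline : Tendsto (fun s : ℝ => z + s • fibVec α) (𝓝[≠] 0) (𝓝 z) := by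
      have : ContinuousAt (fun s : ℝ => z + s • fibVec α) 0 := by fun_prop
      have h2 : Tendsto (fun s : ℝ => z + s • fibVec α) (𝓝 0) (𝓝 z) := by
        simpa [ContinuousAt] using this
      exact h2.mono_left nhdsWithin_le_nhds
    have h1 : Tendsto (fun s : ℝ => h (z + s • fibVec α)) (𝓝[≠] 0) (𝓝 (h z)) :=
      ((hc.continuousAt (hΩ.mem_nhds hz)).tendsto).comp hline
    have h2 : Tendsto (fun s : ℝ => h (z + s • fibVec α)) (𝓝[≠] 0) (𝓝 0) := by
      refine tendsto_const_nhds.congr' ?_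
      filter_upwards [hline.eventually (hΩ.mem_nhds hz), self_mem_nhdsWithin] with s hs hs0
      refine (h0 _ hs ?_).symm
      simpa [fibVec, hzα] using hs0
    exact tendsto_nhds_unique h1 h2
  · exact h0 z hz hzα

theorem hasFDerivAt_fib (α : Fin 3) (z : Total) :
    HasFDerivAt (fun z : Total => z.2 α)
      ((ContinuousLinearMap.proj (R := ℝ) (φ := fun _ : Fin 3 => ℝ) α).comp
        (ContinuousLinearMap.snd ℝ Base Fib)) z :=
  ((ContinuousLinearMap.proj (R := ℝ) (φ := fun _ : Fin 3 => ℝ) α).comp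
    (ContinuousLinearMap.snd ℝ Base Fib)).hasFDerivAt

theorem fderiv_fib_mul_add (α β : Fin 3) {F G : Total → ℝ} {z : Total}
    (hF : DifferentiableAt ℝ F z) (hG : DifferentiableAt ℝ G z) (b : Total) :
    fderiv ℝ (fun z => z.2 α * F z + z.2 β * G z) z b
      = b.2 α * F z + z.2 α * fderiv ℝ F z b + (b.2 β * G z + z.2 β * fderiv ℝ G z b) := by
  have h := ((hasFDerivAt_fib α z).mul hF.hasFDerivAt).add
    ((hasFDerivAt_fib β z).mul hG.hasFDerivAt)
  erw [h.fderiv]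
  simp
  ring

theorem fderiv_fib_mul_sub (α β : Fin 3) {F G : Total → ℝ} {z : Total}
    (hF : DifferentiableAt ℝ F z) (hG : DifferentiableAt ℝ G z) (b : Total) :
    fderiv ℝ (fun z => z.2 α * F z - z.2 β * G z) z b
      = b.2 α * F z + z.2 α * fderiv ℝ F z b - (b.2 β * G z + z.2 β * fderiv ℝ G z b) := by
  have h := ((hasFDerivAt_fib α z).mul hF.hasFDerivAt).sub
    ((hasFDerivAt_fib β z).mul hG.hasFDerivAt)
  erw [h.fderiv]
  simp
  ring

section Components

variable {V : Total → Total} {z : Total}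

theorem contDiffAt_fibComp (hV : ContDiffAt ℝ ∞ V z) (k : Fin 3) :
    ContDiffAt ℝ ∞ (fibComp V k) z :=
  contDiffAt_pi.1 hV.snd k

theorem fderiv_fst_apply (hV : ContDiffAt ℝ ∞ V z) (b : Total) (k : Fin 3) :
    (fderiv ℝ V z b).1 k = fderiv ℝ (baseComp V k) z b :=
  (fderiv_clm_comp ((ContinuousLinearMap.proj (R := ℝ) (φ := fun _ : Fin 3 => ℝ) k).comp
        (ContinuousLinearMap.fst ℝ Base Fib)) (hV.differentiableAt (by simp)) b).symm

theorem fderiv_snd_apply (hV : ContDiffAt ℝ ∞ V z) (b : Total) (k : Fin 3) :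
    (fderiv ℝ V z b).2 k = fderiv ℝ (fibComp V k) z b :=
  (fderiv_clm_comp ((ContinuousLinearMap.proj (R := ℝ) (φ := fun _ : Fin 3 => ℝ) k).comp
        (ContinuousLinearMap.snd ℝ Base Fib)) (hV.differentiableAt (by simp)) b).symm

theorem fderiv_fderiv_fst_apply (hV : ContDiffAt ℝ ∞ V z) (a b : Total) (k : Fin 3) :
    (fderiv ℝ (fderiv ℝ V) z a b).1 k = fderiv ℝ (fderiv ℝ (baseComp V k)) z a b :=
  (fderiv_fderiv_clm_comp ((ContinuousLinearMap.proj (R := ℝ) (φ := fun _ : Fin 3 => ℝ) k).comp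
        (ContinuousLinearMap.fst ℝ Base Fib)) hV a b).symm

theorem fderiv_fderiv_snd_apply (hV : ContDiffAt ℝ ∞ V z) (a b : Total) (k : Fin 3) :
    (fderiv ℝ (fderiv ℝ V) z a b).2 k = fderiv ℝ (fderiv ℝ (fibComp V k)) z a b :=
  (fderiv_fderiv_clm_comp ((ContinuousLinearMap.proj (R := ℝ) (φ := fun _ : Fin 3 => ℝ) k).comp
        (ContinuousLinearMap.snd ℝ Base Fib)) hV a b).symm

/-- The part of the second prolongation that is linear in the second derivatives. -/
def topPart (V : Total → Total) (z : Total) (f₁ : Fin 3 → Fib) (g : Fin 3 → Fin 3 → Fib)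
    (i j : Fin 3) (α : Fin 3) : ℝ :=
  fderiv ℝ (fibComp V α) z (0, g i j) - ∑ k, fderiv ℝ (baseComp V k) z (0, g i j) * f₁ k α
    - ∑ k, fderiv ℝ (baseComp V k) z (Pi.single j 1, f₁ j) * g i k α
    - ∑ k, fderiv ℝ (baseComp V k) z (Pi.single i 1, f₁ i) * g j k α

/-- The part of the second prolongation that does not involve the second derivatives. -/
def lowPart (V : Total → Total) (z : Total) (f₁ : Fin 3 → Fib) (i j : Fin 3) (α : Fin 3) : ℝ :=
  fderiv ℝ (fderiv ℝ (fibComp V α)) z (Pi.single i 1, f₁ i) (Pi.single j 1, f₁ j)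
    - ∑ k, fderiv ℝ (fderiv ℝ (baseComp V k)) z (Pi.single i 1, f₁ i) (Pi.single j 1, f₁ j)
        * f₁ k α

/-- The first-order part of the prolongation. -/
def firstPart (V : Total → Total) (z : Total) (f₁ : Fin 3 → Fib) (i : Fin 3) (α : Fin 3) : ℝ :=
  fderiv ℝ (fibComp V α) z (Pi.single i 1, f₁ i)
    - ∑ k, fderiv ℝ (baseComp V k) z (Pi.single i 1, f₁ i) * f₁ k α

theorem prolongationAt_eq (hV : ContDiffAt ℝ ∞ V z) (f₁ : Fin 3 → Fib)
    (f₂ : Fin 3 → Fin 3 → Fib) : prolongationAt V z f₁ f₂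
      = ((V z).1, fun α => fibComp V α z, fun i α => firstPart V z f₁ i α,
        fun i j α => lowPart V z f₁ i j α + topPart V z f₁ f₂ i j α) := by
  unfold prolongationAt
  congr 3
  · funext i α
    simp [firstPart, fderiv_fst_apply hV, fderiv_snd_apply hV]
  · funext i j α
    simp only [Pi.sub_apply, Prod.snd_add, Pi.add_apply, Finset.sum_apply, Pi.smul_apply,
      smul_eq_mul, Prod.fst_add, add_mul, Finset.sum_add_distrib, lowPart, topPart,
      fderiv_fst_apply hV, fderiv_snd_apply hV, fderiv_fderiv_fst_apply hV,
      fderiv_fderiv_snd_apply hV]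
    ring

theorem topPart_add (f₁ : Fin 3 → Fib) (g h : Fin 3 → Fin 3 → Fib) (i j α : Fin 3) :
    topPart V z f₁ (g + h) i j α = topPart V z f₁ g i j α + topPart V z f₁ h i j α := by
  have e : ((0, (g + h) i j) : Total) = (0, g i j) + (0, h i j) := by simp
  simp only [topPart, e, map_add, add_mul, Finset.sum_add_distrib]
  simp only [Pi.add_apply, mul_add, Finset.sum_add_distrib]
  ring

end Components

/-! ### Splitting the determining equations by order. -/

namespace Coeffs

variable {K : Coeffs} {Ω : Set Total} {V : Total → Total}

/-- The second derivatives of a solution of the equations, all zero except for the one in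
the direction `x`. -/
def particular (K : Coeffs) (r : Fib) (f₁ : Fin 3 → Fib) : Fin 3 → Fin 3 → Fib :=
  fun i j => if i = 0 ∧ j = 0 then
    ![(K.opQ f₁ 1 + K.κ * (r 0 ^ 2 + r 1 ^ 2) * r 0 - K.w * r 0 * r 2) / K.a,
      (-K.opQ f₁ 0 + K.κ * (r 0 ^ 2 + r 1 ^ 2) * r 1 - K.w * r 1 * r 2) / K.a,
      2 * (f₁ 1 0 ^ 2 + f₁ 1 1 ^ 2)] else 0

theorem particular_symm (r : Fib) (f₁ : Fin 3 → Fib) (i j : Fin 3) :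
    K.particular r f₁ i j = K.particular r f₁ j i := by
  simp [particular, and_comm]

theorem eqRe_particular_add (ha : K.a ≠ 0) (p : Base) (r : Fib) (f₁ : Fin 3 → Fib)
    (g : Fin 3 → Fin 3 → Fib) (hg : K.opP g 0 = 0) :
    K.eqRe (p, r, f₁, K.particular r f₁ + g) = 0 := by
  simp only [opP] at hg
  simp [eqRe, particular, opP]
  field_simp
  linear_combination hg

theorem eqIm_particular_add (ha : K.a ≠ 0) (p : Base) (r : Fib) (f₁ : Fin 3 → Fib)
    (g : Fin 3 → Fin 3 → Fib) (hg : K.opP g 1 = 0) :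
    K.eqIm (p, r, f₁, K.particular r f₁ + g) = 0 := by
  simp only [opP] at hg
  simp [eqIm, particular, opP]
  field_simp
  linear_combination hg

theorem eqWave_particular_add (p : Base) (r : Fib) (f₁ : Fin 3 → Fib)
    (g : Fin 3 → Fin 3 → Fib) (hg : g 0 0 2 + K.σ * (g 1 1 2 - g 2 2 2)
      - 2 * (r 0 * g 1 1 0 + r 1 * g 1 1 1) = 0) :
    K.eqWave (p, r, f₁, K.particular r f₁ + g) = 0 := by
  simp [eqWave, particular]
  linear_combination hg

/-- The determining equations that come from the second derivatives. -/
theorem IsSymmetry.top (h : K.IsSymmetry Ω V) (hΩ : IsOpen Ω) (ha : K.a ≠ 0) {z : Total}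
    (hz : z ∈ Ω) (f₁ : Fin 3 → Fib) {g : Fin 3 → Fin 3 → Fib} (hs : ∀ i j, g i j = g j i)
    (h0 : K.opP g 0 = 0) (h1 : K.opP g 1 = 0)
    (h2 : g 0 0 2 + K.σ * (g 1 1 2 - g 2 2 2)
      - 2 * (z.2 0 * g 1 1 0 + z.2 1 * g 1 1 1) = 0) :
    K.opP (topPart V z f₁ g) 0 = 0 ∧ K.opP (topPart V z f₁ g) 1 = 0 ∧
      topPart V z f₁ g 0 0 2 + K.σ * (topPart V z f₁ g 1 1 2 - topPart V z f₁ g 2 2 2)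
        - 2 * (fibComp V 0 z * g 1 1 0 + fibComp V 1 z * g 1 1 1
          + z.2 0 * topPart V z f₁ g 1 1 0 + z.2 1 * topPart V z f₁ g 1 1 1) = 0 := by
  have hV := h.1.contDiffAt (hΩ.mem_nhds hz)
  -- Two solutions with the same first-order data are compared; in the difference everything that
  -- does not involve `g` cancels.
  have A := h.2 z hz f₁ (K.particular z.2 f₁ + g)
    (fun i j => by simp [hs i j, particular_symm (K := K) z.2 f₁ i j])
    (eqRe_particular_add ha _ _ _ _ h0) (eqIm_particular_add ha _ _ _ _ h1)
    (eqWave_particular_add _ _ _ _ h2)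
  have B := h.2 z hz f₁ (K.particular z.2 f₁ + 0)
    (fun i j => by simp [particular_symm (K := K) z.2 f₁ i j])
    (eqRe_particular_add ha _ _ _ _ (by simp [opP]))
    (eqIm_particular_add ha _ _ _ _ (by simp [opP]))
    (eqWave_particular_add _ _ _ _ (by simp))
  rw [add_zero] at B
  simp only [prolongationAt_eq hV, linRe, linIm, linWave, opP, topPart_add, Pi.add_apply] at A B
  simp only [opP]
  obtain ⟨A0, A1, A2⟩ := A
  obtain ⟨B0, B1, B2⟩ := B
  exact ⟨by linear_combination A0 - B0, by linear_combination A1 - B1,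
    by linear_combination A2 - B2⟩

/-- The determining equations that come from the derivatives of order at most one. -/
theorem IsSymmetry.low (h : K.IsSymmetry Ω V) (hΩ : IsOpen Ω) (ha : K.a ≠ 0) {z : Total}
    (hz : z ∈ Ω) (f₁ : Fin 3 → Fib) :
    K.linRe (z.1, z.2, f₁, K.particular z.2 f₁) ((V z).1, fun α => fibComp V α z,
      fun i α => firstPart V z f₁ i α,
      fun i j α => lowPart V z f₁ i j α + topPart V z f₁ (K.particular z.2 f₁) i j α) = 0 ∧
    K.linIm (z.1, z.2, f₁, K.particular z.2 f₁) ((V z).1, fun α => fibComp V α z,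
      fun i α => firstPart V z f₁ i α,
      fun i j α => lowPart V z f₁ i j α + topPart V z f₁ (K.particular z.2 f₁) i j α) = 0 ∧
    K.linWave (z.1, z.2, f₁, K.particular z.2 f₁) ((V z).1, fun α => fibComp V α z,
      fun i α => firstPart V z f₁ i α,
      fun i j α => lowPart V z f₁ i j α + topPart V z f₁ (K.particular z.2 f₁) i j α) = 0 := by
  have hV := h.1.contDiffAt (hΩ.mem_nhds hz)
  have B := h.2 z hz f₁ (K.particular z.2 f₁ + 0)
    (fun i j => by simp [particular_symm (K := K) z.2 f₁ i j])
    (eqRe_particular_add ha _ _ _ _ (by simp [opP]))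
    (eqIm_particular_add ha _ _ _ _ (by simp [opP]))
    (eqWave_particular_add _ _ _ _ (by simp))
  rw [add_zero] at B
  rwa [prolongationAt_eq hV] at B

end Coeffs

theorem map_eq_sum (L : Total →L[ℝ] ℝ) (b : Total) :
    L b = ∑ i, b.1 i * L (baseVec i) + ∑ α, b.2 α * L (fibVec α) := by
  have hb : b = ∑ i, b.1 i • baseVec i + ∑ α, b.2 α • fibVec α := by
    rw [← base_eq_sum, ← fib_eq_sum]
    simp
  conv_lhs => rw [hb]
  simp only [map_add, map_sum, map_smul, smul_eq_mul]

theorem topPart_expand (V : Total → Total) (z : Total) (f₁ : Fin 3 → Fib)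
    (g : Fin 3 → Fin 3 → Fib) (i j α : Fin 3) : topPart V z f₁ g i j α
      = ∑ β, g i j β * fderiv ℝ (fibComp V α) z (fibVec β)
        - ∑ k, (∑ β, g i j β * fderiv ℝ (baseComp V k) z (fibVec β)) * f₁ k α
        - ∑ k, (fderiv ℝ (baseComp V k) z (baseVec j)
          + ∑ β, f₁ j β * fderiv ℝ (baseComp V k) z (fibVec β)) * g i k α
        - ∑ k, (fderiv ℝ (baseComp V k) z (baseVec i)
          + ∑ β, f₁ i β * fderiv ℝ (baseComp V k) z (fibVec β)) * g j k α := by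
  simp only [topPart, horizontal_eq_sum, fib_eq_sum, map_add, map_sum, map_smul, smul_eq_mul]

/-! ### Determining equations from second derivatives. -/

namespace Coeffs

/-- The nondegeneracy properties of the coefficients that determine the symmetries; the vector
`(n, d)` spans the characteristic direction of the second-order part of the first equation. -/
structure Nondegenerate (K : Coeffs) (n d : ℝ) : Prop where
  a_ne : K.a ≠ 0
  a₄_ne : K.a₄ ≠ 0
  σ_ne : K.σ ≠ 0
  w_ne : K.w ≠ 0
  a₂_sub_a₃ : K.a₂ - K.a₃ ≠ 0
  n_ne : n ≠ 0
  d_ne : d ≠ 0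
  sq_sub_sq : n ^ 2 - d ^ 2 ≠ 0
  null_n : 2 * K.a₂ * n + K.a₄ * d = 0
  null_d : 2 * K.a₃ * d + K.a₄ * n = 0
  drift : K.a₁ * d + K.a₅ * n ≠ 0

variable {K : Coeffs} {Ω : Set Total} {V : Total → Total} {n d : ℝ}

/-- `φ_ty` occurs in no equation and is free. Through the term `a₄ ψ_ty` it enters the linearised
first equation, multiplied only by `φ`-derivatives of `η` and `ξ`. -/
theorem IsSymmetry.fderiv_fibVec_two (h : K.IsSymmetry Ω V) (hΩ : IsOpen Ω)
    (hK : K.Nondegenerate n d) {z : Total} (hz : z ∈ Ω) :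
    fderiv ℝ (fibComp V 0) z (fibVec 2) = 0 ∧ fderiv ℝ (fibComp V 1) z (fibVec 2) = 0 ∧
      ∀ k, fderiv ℝ (baseComp V k) z (fibVec 2) = 0 := by
  have A := fun f₁ => h.top hΩ hK.a_ne hz f₁
    (g := ![![0, 0, 0], ![0, 0, ![0, 0, 1]], ![0, ![0, 0, 1], 0]])
    (by intro i j; fin_cases i <;> fin_cases j <;> rfl) (by simp [opP]) (by simp [opP]) (by simp)
  -- Vanishing first derivatives isolate `∂_φ η`; a single `u_k = 1` brings in `∂_φ ξ^k`.
  have A0 := A 0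
  have A1 := A ![![1, 0, 0], 0, 0]
  have A2 := A ![0, ![1, 0, 0], 0]
  have A3 := A ![0, 0, ![1, 0, 0]]
  simp [opP, topPart_expand, Fin.sum_univ_three, hK.a₄_ne] at A0 A1 A2 A3
  refine ⟨A0.1, A0.2.1, fun k => ?_⟩
  match k with
  | 0 => linear_combination A0.1 - A1.1
  | 1 => linear_combination A0.1 - A2.1
  | 2 => linear_combination A0.1 - A3.1

/-- `φ_xy` and `φ_xt` are free too. Their coefficients in the linearised wave equation are total
derivatives of `ξ`, which depend on the first derivatives of `u` and `v` through `∂_u ξ` and `∂_v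
ξ`. -/
theorem IsSymmetry.fderiv_baseComp_fibVec (h : K.IsSymmetry Ω V) (hΩ : IsOpen Ω)
    (hK : K.Nondegenerate n d) {z : Total} (hz : z ∈ Ω) (k β : Fin 3) :
    fderiv ℝ (baseComp V k) z (fibVec β) = 0 := by
  have hφ := (h.fderiv_fibVec_two hΩ hK hz).2.2
  have A := fun f₁ => (h.top hΩ hK.a_ne hz f₁
    (g := ![![0, ![0, 0, 1], 0], ![![0, 0, 1], 0, 0], ![0, 0, 0]])
    (by intro i j; fin_cases i <;> fin_cases j <;> rfl) (by simp [opP]) (by simp [opP])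
    (by simp)).2.2
  have B := fun f₁ => (h.top hΩ hK.a_ne hz f₁
    (g := ![![0, 0, ![0, 0, 1]], ![0, 0, 0], ![![0, 0, 1], 0, 0]])
    (by intro i j; fin_cases i <;> fin_cases j <;> rfl) (by simp [opP]) (by simp [opP])
    (by simp)).2.2
  have A0 := A 0
  have B0 := B 0
  have A1 := A ![![1, 0, 0], 0, 0]
  have A2 := A ![0, ![1, 0, 0], 0]
  have B1 := B ![![1, 0, 0], 0, 0]
  have A3 := A ![![0, 1, 0], 0, 0]
  have A4 := A ![0, ![0, 1, 0], 0]
  have B2 := B ![![0, 1, 0], 0, 0]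
  simp [topPart_expand, Fin.sum_univ_three, hφ] at A0 A1 A2 B0 B1 A3 A4 B2
  match k, β with
  | k, 2 => exact hφ k
  | 0, 0 =>
    refine mul_left_cancel₀ hK.σ_ne ?_
    linear_combination (A0 - A2) / 2
  | 1, 0 => linear_combination (A0 - A1) / 2
  | 2, 0 => linear_combination (B0 - B1) / 2
  | 0, 1 =>
    refine mul_left_cancel₀ hK.σ_ne ?_
    linear_combination (A0 - A4) / 2
  | 1, 1 => linear_combination (A0 - A3) / 2
  | 2, 1 => linear_combination (B0 - B2) / 2

/-- The second derivatives of `φ` are constrained only by the wave equation, so `ξ` must preserve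
its principal part up to a factor: these are the conformal Killing equations. -/
theorem IsSymmetry.conformal (h : K.IsSymmetry Ω V) (hΩ : IsOpen Ω)
    (hK : K.Nondegenerate n d) {z : Total} (hz : z ∈ Ω) :
    fderiv ℝ (baseComp V 1) z (baseVec 0) + K.σ * fderiv ℝ (baseComp V 0) z (baseVec 1) = 0 ∧
    fderiv ℝ (baseComp V 2) z (baseVec 0) - K.σ * fderiv ℝ (baseComp V 0) z (baseVec 2) = 0 ∧
    fderiv ℝ (baseComp V 2) z (baseVec 1) = fderiv ℝ (baseComp V 1) z (baseVec 2) ∧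
    fderiv ℝ (baseComp V 1) z (baseVec 1) = fderiv ℝ (baseComp V 0) z (baseVec 0) ∧
    fderiv ℝ (baseComp V 2) z (baseVec 2) = fderiv ℝ (baseComp V 0) z (baseVec 0) := by
  have hX := h.fderiv_baseComp_fibVec hΩ hK hz
  have hφ := (h.fderiv_fibVec_two hΩ hK hz)
  have A := (h.top hΩ hK.a_ne hz 0
    (g := ![![0, ![0, 0, 1], 0], ![![0, 0, 1], 0, 0], ![0, 0, 0]])
    (by intro i j; fin_cases i <;> fin_cases j <;> rfl) (by simp [opP]) (by simp [opP])
    (by simp)).2.2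
  have B := (h.top hΩ hK.a_ne hz 0
    (g := ![![0, 0, ![0, 0, 1]], ![0, 0, 0], ![![0, 0, 1], 0, 0]])
    (by intro i j; fin_cases i <;> fin_cases j <;> rfl) (by simp [opP]) (by simp [opP])
    (by simp)).2.2
  have C := (h.top hΩ hK.a_ne hz 0
    (g := ![![0, 0, 0], ![0, 0, ![0, 0, 1]], ![0, ![0, 0, 1], 0]])
    (by intro i j; fin_cases i <;> fin_cases j <;> rfl) (by simp [opP]) (by simp [opP])
    (by simp)).2.2
  have D := (h.top hΩ hK.a_ne hz 0
    (g := ![![![0, 0, -K.σ], 0, 0], ![0, ![0, 0, 1], 0], ![0, 0, 0]])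
    (by intro i j; fin_cases i <;> fin_cases j <;> rfl) (by simp [opP]) (by simp [opP])
    (by simp)).2.2
  have E := (h.top hΩ hK.a_ne hz 0
    (g := ![![![0, 0, K.σ], 0, 0], ![0, 0, 0], ![0, 0, ![0, 0, 1]]])
    (by intro i j; fin_cases i <;> fin_cases j <;> rfl) (by simp [opP]) (by simp [opP])
    (by simp)).2.2
  simp [topPart_expand, Fin.sum_univ_three, hX, hφ] at A B C D E
  replace C := C.resolve_left hK.σ_ne
  refine ⟨by linear_combination -A / 2, by linear_combination -B / 2,
    by linear_combination -C / 2, ?_, ?_⟩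
  · refine mul_left_cancel₀ hK.σ_ne ?_
    linear_combination -D / 2
  · refine mul_left_cancel₀ hK.σ_ne ?_
    linear_combination E / 2

theorem IsSymmetry.contDiffOn_baseComp (h : K.IsSymmetry Ω V) (k : Fin 3) :
    ContDiffOn ℝ ∞ (baseComp V k) Ω :=
  contDiffOn_pi.1 h.1.fst k

theorem IsSymmetry.contDiffOn_fibComp (h : K.IsSymmetry Ω V) (k : Fin 3) :
    ContDiffOn ℝ ∞ (fibComp V k) Ω :=
  contDiffOn_pi.1 h.1.snd k

/-- `u_xy` occurs in no equation, but the prolongation of `u u_yy` produces a multiple of `u (∂_y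
ξ^x) u_xy`. This settles `u ≠ 0`; continuity does the rest. -/
theorem IsSymmetry.fderiv_baseComp_zero_one (h : K.IsSymmetry Ω V) (hΩ : IsOpen Ω)
    (hK : K.Nondegenerate n d) : ∀ z ∈ Ω, fderiv ℝ (baseComp V 0) z (baseVec 1) = 0 := by
  refine eq_zero_of_fib_ne_zero hΩ 0
    (contDiffOn_fderiv_apply hΩ (h.contDiffOn_baseComp 0) _).continuousOn fun z hz hu => ?_
  have hX := h.fderiv_baseComp_fibVec hΩ hK hz
  have A := (h.top hΩ hK.a_ne hz 0
    (g := ![![0, ![1, 0, 0], 0], ![![1, 0, 0], 0, 0], ![0, 0, 0]])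
    (by intro i j; fin_cases i <;> fin_cases j <;> rfl) (by simp [opP]) (by simp [opP])
    (by simp)).2.2
  simp [topPart_expand, Fin.sum_univ_three, hX, hu] at A
  linear_combination -A / 2

/-- The rotations and boosts that the wave operator admits are excluded by the coupling to `ψ`: `a₄
≠ 0` forbids mixing `x` with `t`, and `a₂ ≠ a₃` forbids mixing `y` with `t`. A multiple of the
identity remains. -/
theorem IsSymmetry.fderiv_baseComp (h : K.IsSymmetry Ω V) (hΩ : IsOpen Ω)
    (hK : K.Nondegenerate n d) {z : Total} (hz : z ∈ Ω) (k : Fin 3) (b : Total) :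
    fderiv ℝ (baseComp V k) z b = fderiv ℝ (baseComp V 0) z (baseVec 0) * b.1 k := by
  have hX := h.fderiv_baseComp_fibVec hΩ hK hz
  have hφ := (h.fderiv_fibVec_two hΩ hK hz)
  have h01 := h.fderiv_baseComp_zero_one hΩ hK z hz
  obtain ⟨hxy, hxt, hyt, hyy, htt⟩ := h.conformal hΩ hK hz
  have h10 : fderiv ℝ (baseComp V 1) z (baseVec 0) = 0 := by
    rw [h01] at hxy
    linear_combination hxy
  have A := (h.top hΩ hK.a_ne hz 0
    (g := ![![0, ![1, 0, 0], 0], ![![1, 0, 0], 0, 0], ![0, 0, 0]])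
    (by intro i j; fin_cases i <;> fin_cases j <;> rfl) (by simp [opP]) (by simp [opP])
    (by simp)).1
  -- Here `a₂ u_yy + a₃ u_tt = 0`, and `φ_xx = 2 a₃ u` balances `2 u u_yy`.
  have B := (h.top hΩ hK.a_ne hz 0
    (g := ![![![0, 0, 2 * K.a₃ * z.2 0], 0, 0], ![0, ![K.a₃, 0, 0], 0], ![0, 0, ![-K.a₂, 0, 0]]])
    (by intro i j; fin_cases i <;> fin_cases j <;> rfl) (by simp [opP]; ring) (by simp [opP])
    (by simp; ring)).1
  simp [opP, topPart_expand, Fin.sum_univ_three, hX, hφ, h01, h10, hyy, htt, hyt, hK.a₄_ne] at A B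
  have h20 : fderiv ℝ (baseComp V 2) z (baseVec 0) = 0 := by
    rw [A] at hxt
    linear_combination hxt
  have h12 : fderiv ℝ (baseComp V 1) z (baseVec 2) = 0 := by
    refine (mul_eq_zero.1 (?_ : (K.a₄ * (K.a₂ - K.a₃)) * _ = 0)).resolve_left
      (mul_ne_zero hK.a₄_ne hK.a₂_sub_a₃)
    linear_combination B
  rw [map_eq_sum]
  simp only [hX, Fin.sum_univ_three]
  match k with
  | 0 => simp [A, h01, mul_comm]
  | 1 => simp [h10, h12, hyy, mul_comm]
  | 2 => simp [h20, h12, htt, hyt, mul_comm]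

/-- If `∂_b ξ^k = μ b^k`, the symmetry of the second derivatives of `ξ^k` reads `(∂_a μ) b^k = (∂_b
μ) a^k`; in more than one base dimension this forces `dμ = 0`. -/
theorem IsSymmetry.fderiv_dilation (h : K.IsSymmetry Ω V) (hΩ : IsOpen Ω)
    (hK : K.Nondegenerate n d) {z : Total} (hz : z ∈ Ω) (a : Total) :
    fderiv ℝ (fun y => fderiv ℝ (baseComp V 0) y (baseVec 0)) z a = 0 := by
  set μ : Total → ℝ := fun y => fderiv ℝ (baseComp V 0) y (baseVec 0) with hμ
  have hμd : DifferentiableAt ℝ μ z := ContDiffOn.differentiableAt_of_isOpen hΩ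
    (contDiffOn_fderiv_apply hΩ (h.contDiffOn_baseComp 0) _) hz
  have h2 : ∀ (k : Fin 3) (a b : Total),
      fderiv ℝ (fderiv ℝ (baseComp V k)) z a b = fderiv ℝ μ z a * b.1 k := by
    intro k a b
    rw [fderiv_fderiv_eq_of_fderiv_eq hΩ (h.contDiffOn_baseComp k)
      (fun y hy => h.fderiv_baseComp hΩ hK hy k b) hz, fderiv_mul_const hμd]
    simp [mul_comm]
  have h3 : ∀ (k : Fin 3) (a b : Total), fderiv ℝ μ z a * b.1 k = fderiv ℝ μ z b * a.1 k := by
    intro k a b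
    rw [← h2, ← h2, fderiv_fderiv_comm ((h.contDiffOn_baseComp k).contDiffAt (hΩ.mem_nhds hz))]
  have e1 := h3 1 (baseVec 0) (baseVec 1)
  have e2 := h3 0 a (baseVec 0)
  simp [baseVec] at e1 e2
  rw [e2, e1, zero_mul]

theorem IsSymmetry.fderiv_fderiv_baseComp (h : K.IsSymmetry Ω V) (hΩ : IsOpen Ω)
    (hK : K.Nondegenerate n d) {z : Total} (hz : z ∈ Ω) (k : Fin 3) (a b : Total) :
    fderiv ℝ (fderiv ℝ (baseComp V k)) z a b = 0 := by
  rw [fderiv_fderiv_eq_of_fderiv_eq hΩ (h.contDiffOn_baseComp k)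
      (fun y hy => h.fderiv_baseComp hΩ hK hy k b) hz, fderiv_mul_const
      (ContDiffOn.differentiableAt_of_isOpen hΩ
    (contDiffOn_fderiv_apply hΩ (h.contDiffOn_baseComp 0) _) hz)]
  simp [h.fderiv_dilation hΩ hK hz]

/-- `u_xx = -a₄`, `u_yt = a` solves the homogeneous first equation, and the linearised wave equation
sees it only through `u_xx ∂_u η^φ`; likewise for `v`. -/
theorem IsSymmetry.fderiv_fibComp_two (h : K.IsSymmetry Ω V) (hΩ : IsOpen Ω)
    (hK : K.Nondegenerate n d) {z : Total} (hz : z ∈ Ω) :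
    fderiv ℝ (fibComp V 2) z (fibVec 0) = 0 ∧ fderiv ℝ (fibComp V 2) z (fibVec 1) = 0 := by
  have hX := h.fderiv_baseComp hΩ hK hz
  have hφ := h.fderiv_fibVec_two hΩ hK hz
  have A := (h.top hΩ hK.a_ne hz 0
    (g := ![![![-K.a₄, 0, 0], 0, 0], ![0, 0, ![K.a, 0, 0]], ![0, ![K.a, 0, 0], 0]])
    (by intro i j; fin_cases i <;> fin_cases j <;> rfl) (by simp [opP]; ring) (by simp [opP])
    (by simp)).2.2
  have B := (h.top hΩ hK.a_ne hz 0
    (g := ![![![0, -K.a₄, 0], 0, 0], ![0, 0, ![0, K.a, 0]], ![0, ![0, K.a, 0], 0]])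
    (by intro i j; fin_cases i <;> fin_cases j <;> rfl) (by simp [opP]) (by simp [opP]; ring)
    (by simp)).2.2
  have e : ∀ k i, fderiv ℝ (baseComp V k) z (baseVec i)
      = fderiv ℝ (baseComp V 0) z (baseVec 0) * (Pi.single i 1 : Base) k := fun k i => hX k _
  have e' : ∀ k i, fderiv ℝ (baseComp V k) z (fibVec i) = 0 :=
    h.fderiv_baseComp_fibVec hΩ hK hz
  simp [topPart_expand, Fin.sum_univ_three, e 1 2, e 2 1, e', hK.a₄_ne] at A B
  exact ⟨A, B⟩

/-- The choice `u_xx = -a₂`, `u_yy = a`, `φ_xx = 2 a u`, and its analogue for `v`, solves the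
homogeneous equations. The coupling `u u_yy + v v_yy` then ties the `ψ`-component of `V` to `∂_φ
η^φ`. -/
theorem IsSymmetry.euler (h : K.IsSymmetry Ω V) (hΩ : IsOpen Ω)
    (hK : K.Nondegenerate n d) {z : Total} (hz : z ∈ Ω) :
    fibComp V 0 z + z.2 0 * fderiv ℝ (fibComp V 0) z (fibVec 0)
        + z.2 1 * fderiv ℝ (fibComp V 1) z (fibVec 0)
      = z.2 0 * fderiv ℝ (fibComp V 2) z (fibVec 2) ∧
    fibComp V 1 z + z.2 0 * fderiv ℝ (fibComp V 0) z (fibVec 1)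
        + z.2 1 * fderiv ℝ (fibComp V 1) z (fibVec 1)
      = z.2 1 * fderiv ℝ (fibComp V 2) z (fibVec 2) := by
  have hX := h.fderiv_baseComp hΩ hK hz
  have hφ := h.fderiv_fibVec_two hΩ hK hz
  have hw := h.fderiv_fibComp_two hΩ hK hz
  have A := (h.top hΩ hK.a_ne hz 0
    (g := ![![![-K.a₂, 0, 2 * K.a * z.2 0], 0, 0], ![0, ![K.a, 0, 0], 0], ![0, 0, 0]])
    (by intro i j; fin_cases i <;> fin_cases j <;> rfl) (by simp [opP]; ring) (by simp [opP])
    (by simp; ring)).2.2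
  have B := (h.top hΩ hK.a_ne hz 0
    (g := ![![![0, -K.a₂, 2 * K.a * z.2 1], 0, 0], ![0, ![0, K.a, 0], 0], ![0, 0, 0]])
    (by intro i j; fin_cases i <;> fin_cases j <;> rfl) (by simp [opP]) (by simp [opP]; ring)
    (by simp; ring)).2.2
  have e : ∀ k i, fderiv ℝ (baseComp V k) z (baseVec i)
      = fderiv ℝ (baseComp V 0) z (baseVec 0) * (Pi.single i 1 : Base) k := fun k i => hX k _
  have e' : ∀ k i, fderiv ℝ (baseComp V k) z (fibVec i) = 0 :=
    h.fderiv_baseComp_fibVec hΩ hK hz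
  simp [topPart_expand, Fin.sum_univ_three, e 1 1, e', hw] at A B
  constructor
  · refine mul_left_cancel₀ hK.a_ne ?_
    linear_combination -A / 2
  · refine mul_left_cancel₀ hK.a_ne ?_
    linear_combination -B / 2

end Coeffs

/-! ### Determining equations from first derivatives. -/

namespace Coeffs

variable {K : Coeffs} {Ω : Set Total} {V : Total → Total} {n d : ℝ}

theorem IsSymmetry.low_expand (h : K.IsSymmetry Ω V) (hΩ : IsOpen Ω)
    (hK : K.Nondegenerate n d) {z : Total} (hz : z ∈ Ω) (f₁ : Fin 3 → Fib) (i j α : Fin 3) :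
    lowPart V z f₁ i j α = fderiv ℝ (fderiv ℝ (fibComp V α)) z (baseVec i + (0, f₁ i))
      (baseVec j + (0, f₁ j)) := by
  simp [lowPart, h.fderiv_fderiv_baseComp hΩ hK hz, baseVec]

theorem IsSymmetry.first_expand (h : K.IsSymmetry Ω V) (hΩ : IsOpen Ω)
    (hK : K.Nondegenerate n d) {z : Total} (hz : z ∈ Ω) (f₁ : Fin 3 → Fib) (i α : Fin 3) :
    firstPart V z f₁ i α = fderiv ℝ (fibComp V α) z (baseVec i)
      + fderiv ℝ (fibComp V α) z (0, f₁ i)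
      - fderiv ℝ (baseComp V 0) z (baseVec 0) * f₁ i α := by
  have hX := h.fderiv_baseComp hΩ hK hz
  have e : ((Pi.single i 1, f₁ i) : Total) = baseVec i + (0, f₁ i) := by simp [baseVec]
  have e2 : ∑ k, fderiv ℝ (baseComp V k) z (Pi.single i 1, f₁ i) * f₁ k α
      = fderiv ℝ (baseComp V 0) z (baseVec 0) * f₁ i α := by
    rw [Finset.sum_eq_single i]
    · rw [hX]; simp
    · intro k _ hk
      rw [hX]; simp [hk]
    · simp
  rw [firstPart, e2, e, map_add]

theorem IsSymmetry.top_expand (h : K.IsSymmetry Ω V) (hΩ : IsOpen Ω)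
    (hK : K.Nondegenerate n d) {z : Total} (hz : z ∈ Ω) (f₁ : Fin 3 → Fib)
    (g : Fin 3 → Fin 3 → Fib) (i j α : Fin 3) :
    topPart V z f₁ g i j α = fderiv ℝ (fibComp V α) z (0, g i j)
      - fderiv ℝ (baseComp V 0) z (baseVec 0) * (g i j α + g j i α) := by
  have hX := h.fderiv_baseComp hΩ hK hz
  have e1 : ∑ k, fderiv ℝ (baseComp V k) z (0, g i j) * f₁ k α = 0 :=
    Finset.sum_eq_zero fun k _ => by rw [hX]; simp
  have e2 : ∀ i j, ∑ k, fderiv ℝ (baseComp V k) z (Pi.single j 1, f₁ j) * g i k α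
      = fderiv ℝ (baseComp V 0) z (baseVec 0) * g i j α := by
    intro i j
    rw [Finset.sum_eq_single j]
    · rw [hX]; simp
    · intro k _ hk
      rw [hX]; simp [hk]
    · simp
  rw [topPart, e1, e2, e2]
  ring

theorem mk_zero_zero : ((0, 0) : Total) = 0 := rfl

theorem map_fib (L : Total →L[ℝ] ℝ) (r : Fib) :
    L (0, r) = r 0 * L (fibVec 0) + r 1 * L (fibVec 1) + r 2 * L (fibVec 2) := by
  rw [map_eq_sum]
  simp [Fin.sum_univ_three]

/-- First derivatives in `x` occur in no equation, so passing from `f₁ = 0` to `f₁ = (r, 0, 0)`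
changes only the second derivatives of `η` in the prolonged `xx`-term. -/
theorem IsSymmetry.x_direction (h : K.IsSymmetry Ω V) (hΩ : IsOpen Ω)
    (hK : K.Nondegenerate n d) {z : Total} (hz : z ∈ Ω) (α : Fin 3) (r : Fib) :
    2 * fderiv ℝ (fderiv ℝ (fibComp V α)) z (baseVec 0) (0, r)
      + fderiv ℝ (fderiv ℝ (fibComp V α)) z (0, r) (0, r) = 0 := by
  have A := h.low hΩ hK.a_ne hz 0
  have B := h.low hΩ hK.a_ne hz ![r, 0, 0]
  have e : K.particular z.2 ![r, 0, 0] = K.particular z.2 0 := by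
    funext i j
    simp [particular, opQ]
  have hc := fderiv_fderiv_comm ((h.contDiffOn_fibComp α).contDiffAt (hΩ.mem_nhds hz))
    (0, r) (baseVec 0)
  rw [e] at B
  simp only [linRe, linIm, linWave, opP, opQ, h.low_expand hΩ hK hz, h.first_expand hΩ hK hz,
    h.top_expand hΩ hK hz] at A B
  simp [mk_zero_zero] at A B
  match α with
  | 0 =>
    refine mul_left_cancel₀ hK.a_ne ?_
    linear_combination B.1 - A.1 - K.a * hc
  | 1 =>
    refine mul_left_cancel₀ hK.a_ne ?_
    linear_combination B.2.1 - A.2.1 - K.a * hc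
  | 2 => linear_combination B.2.2 - A.2.2 - hc

/-- The part of `x_direction` that is odd in `r`. -/
theorem IsSymmetry.fderiv_fderiv_x (h : K.IsSymmetry Ω V) (hΩ : IsOpen Ω)
    (hK : K.Nondegenerate n d) {z : Total} (hz : z ∈ Ω) (α : Fin 3) (r : Fib) :
    fderiv ℝ (fderiv ℝ (fibComp V α)) z (baseVec 0) (0, r) = 0 := by
  have A := h.x_direction hΩ hK hz α r
  have B := h.x_direction hΩ hK hz α (-r)
  have e : ((0, -r) : Total) = -(0, r) := by simp
  rw [e] at B
  simp only [map_neg, neg_apply] at B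
  linear_combination (A - B) / 4

/-- The even part of `x_direction`, polarised: `η` is locally affine in the fibre variables. -/
theorem IsSymmetry.fderiv_fderiv_fib (h : K.IsSymmetry Ω V) (hΩ : IsOpen Ω)
    (hK : K.Nondegenerate n d) {z : Total} (hz : z ∈ Ω) (α : Fin 3) (r s : Fib) :
    fderiv ℝ (fderiv ℝ (fibComp V α)) z (0, r) (0, s) = 0 := by
  have D : ∀ r, fderiv ℝ (fderiv ℝ (fibComp V α)) z (0, r) (0, r) = 0 := fun r => by
    have A := h.x_direction hΩ hK hz α r
    rw [h.fderiv_fderiv_x hΩ hK hz] at A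
    linear_combination A
  have hc := fderiv_fderiv_comm ((h.contDiffOn_fibComp α).contDiffAt (hΩ.mem_nhds hz))
    (0, r) (0, s)
  have A := D (r + s)
  have e : ((0, r + s) : Total) = (0, r) + (0, s) := by simp
  rw [e] at A
  simp only [map_add, add_apply, D] at A
  linear_combination (A + hc) / 2

/-- The equations that come from first derivatives `s i • r`. -/
theorem IsSymmetry.yt_direction (h : K.IsSymmetry Ω V) (hΩ : IsOpen Ω)
    (hK : K.Nondegenerate n d) {z : Total} (hz : z ∈ Ω) (s₁ s₂ : ℝ) (r : Fib) :
    fderiv ℝ (fderiv ℝ (fibComp V 0)) z (0, r)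
        ((2 * K.a₂ * s₁ + K.a₄ * s₂) • baseVec 1 + (2 * K.a₃ * s₂ + K.a₄ * s₁) • baseVec 2)
      + (K.a₁ * s₂ + K.a₅ * s₁) * (r 1 * fderiv ℝ (fibComp V 0) z (fibVec 0)
        - r 0 * fderiv ℝ (fibComp V 0) z (fibVec 1) - r 0 * fderiv ℝ (fibComp V 1) z (fibVec 0)
        - r 1 * fderiv ℝ (fibComp V 1) z (fibVec 1)
        - r 1 * fderiv ℝ (baseComp V 0) z (baseVec 0)) = 0 ∧
    fderiv ℝ (fderiv ℝ (fibComp V 1)) z (0, r)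
        ((2 * K.a₂ * s₁ + K.a₄ * s₂) • baseVec 1 + (2 * K.a₃ * s₂ + K.a₄ * s₁) • baseVec 2)
      + (K.a₁ * s₂ + K.a₅ * s₁) * (r 1 * fderiv ℝ (fibComp V 1) z (fibVec 0)
        - r 0 * fderiv ℝ (fibComp V 1) z (fibVec 1) + r 0 * fderiv ℝ (fibComp V 0) z (fibVec 0)
        + r 1 * fderiv ℝ (fibComp V 0) z (fibVec 1)
        + r 0 * fderiv ℝ (baseComp V 0) z (baseVec 0)) = 0 := by
  have hφ := h.fderiv_fibVec_two hΩ hK hz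
  have A := h.low hΩ hK.a_ne hz 0
  -- Since `η` has no second derivatives along the fibre, the difference from `f₁ = 0` is linear in
  -- `(s₁, s₂)`; its second-order part is the gradient of `a₂ s₁² + a₄ s₁ s₂ + a₃ s₂²`.
  have B := h.low hΩ hK.a_ne hz ![0, s₁ • r, s₂ • r]
  have hc := fun α i => fderiv_fderiv_comm
    ((h.contDiffOn_fibComp α).contDiffAt (hΩ.mem_nhds hz)) (baseVec i) (0, r)
  have e1 : ∀ s : ℝ, ((0, s • r) : Total) = s • (0, r) := fun s => by simp
  have hp : ∀ f₁ α, K.particular z.2 f₁ 0 0 α =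
    ![(K.opQ f₁ 1 + K.κ * (z.2 0 ^ 2 + z.2 1 ^ 2) * z.2 0 - K.w * z.2 0 * z.2 2) / K.a,
      (-K.opQ f₁ 0 + K.κ * (z.2 0 ^ 2 + z.2 1 ^ 2) * z.2 1 - K.w * z.2 1 * z.2 2) / K.a,
      2 * (f₁ 1 0 ^ 2 + f₁ 1 1 ^ 2)] α := fun f₁ α => by simp [particular]
  have hp1 : ∀ f₁, K.particular z.2 f₁ 1 1 = 0 := fun f₁ => by simp [particular]
  have hp2 : ∀ f₁, K.particular z.2 f₁ 2 2 = 0 := fun f₁ => by simp [particular]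
  have hp3 : ∀ f₁, K.particular z.2 f₁ 2 1 = 0 := fun f₁ => by simp [particular]
  have hp4 : ∀ f₁, K.particular z.2 f₁ 1 2 = 0 := fun f₁ => by simp [particular]
  have hA := A.1
  have hA' := A.2.1
  have hB := B.1
  have hB' := B.2.1
  clear A B
  simp only [linRe, linIm, opP, h.low_expand hΩ hK hz, h.first_expand hΩ hK hz,
    h.top_expand hΩ hK hz, map_fib _ (K.particular _ _ _ _), hp, hp1, hp2, hp3, hp4, hφ]
    at hA hA' hB hB'
  simp [-Prod.smul_mk, mk_zero_zero, e1, opQ, hc, h.fderiv_fderiv_fib hΩ hK hz] at hA hA' hB hB' ⊢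
  have ha := hK.a_ne
  field_simp at hA hA' hB hB' ⊢
  have hm0 := map_fib (fderiv ℝ (fibComp V 0) z) r
  have hm1 := map_fib (fderiv ℝ (fibComp V 1) z) r
  rw [hφ.1] at hm0
  rw [hφ.2.1] at hm1
  constructor
  · linear_combination hB - hA + (K.a₁ * s₂ + K.a₅ * s₁) * hm1
  · linear_combination hB' - hA' - (K.a₁ * s₂ + K.a₅ * s₁) * hm0

/-- At the null covector `(n, d)` the gradient of the quadratic form vanishes and only the nonzero
drift remains. The dilation disappears because it scales first- and second-order terms differently.
-/
theorem IsSymmetry.cauchyRiemann (h : K.IsSymmetry Ω V) (hΩ : IsOpen Ω)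
    (hK : K.Nondegenerate n d) {z : Total} (hz : z ∈ Ω) :
    fderiv ℝ (baseComp V 0) z (baseVec 0) = 0 ∧
    fderiv ℝ (fibComp V 1) z (fibVec 1) = fderiv ℝ (fibComp V 0) z (fibVec 0) ∧
    fderiv ℝ (fibComp V 0) z (fibVec 1) = -fderiv ℝ (fibComp V 1) z (fibVec 0) := by
  have A := h.yt_direction hΩ hK hz n d ![1, 0, 0]
  have B := h.yt_direction hΩ hK hz n d ![0, 1, 0]
  simp [hK.null_n, hK.null_d, hK.drift] at A B
  refine ⟨?_, ?_, ?_⟩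
  · linear_combination (A.2 - B.1) / 2
  · linear_combination -(A.2 + B.1) / 2
  · linear_combination -A.1

/-- By `cauchyRiemann` the drift bracket vanishes for every covector, so the second-order term at
`(0, 1)` vanishes alone; `null_d` makes its direction a multiple of `d ∂_y - n ∂_t`, along which the
phase is constant. -/
theorem IsSymmetry.fderiv_fderiv_null (h : K.IsSymmetry Ω V) (hΩ : IsOpen Ω)
    (hK : K.Nondegenerate n d) {z : Total} (hz : z ∈ Ω) (r : Fib) :
    fderiv ℝ (fderiv ℝ (fibComp V 0)) z (0, r) (d • baseVec 1 - n • baseVec 2) = 0 ∧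
    fderiv ℝ (fderiv ℝ (fibComp V 1)) z (0, r) (d • baseVec 1 - n • baseVec 2) = 0 := by
  obtain ⟨h0, h1, h2⟩ := h.cauchyRiemann hΩ hK hz
  have A := h.yt_direction hΩ hK hz 0 1 r
  simp only [h0, h1, h2, map_add, map_sub, map_smul, smul_eq_mul] at A ⊢
  have hn := hK.null_d
  constructor
  · refine mul_left_cancel₀ hK.a₄_ne ?_
    linear_combination d * A.1 -
      fderiv ℝ (fderiv ℝ (fibComp V 0)) z (0, r) (baseVec 2) * hn
  · refine mul_left_cancel₀ hK.a₄_ne ?_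
    linear_combination d * A.2 -
      fderiv ℝ (fderiv ℝ (fibComp V 1)) z (0, r) (baseVec 2) * hn

end Coeffs

/-! ### Functions of the phase. -/

/-- The linear form `d t + n y`. -/
def phaseForm (n d : ℝ) (b : Total) : ℝ := d * b.1 2 + n * b.1 1

/-- A vector on which `phaseForm` takes the value one. -/
def phaseVec (d : ℝ) : Total := d⁻¹ • baseVec 2

theorem phaseForm_phaseVec {n d : ℝ} (hd : d ≠ 0) : phaseForm n d (phaseVec d) = 1 := by
  simp [phaseForm, phaseVec, baseVec, hd]

theorem phaseForm_fibVec (n d : ℝ) (β : Fin 3) : phaseForm n d (fibVec β) = 0 := by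
  simp [phaseForm, fibVec]

/-- The derivative of a function in the direction `phaseVec`. -/
def phaseDeriv (d : ℝ) (f : Total → ℝ) (z : Total) : ℝ := fderiv ℝ f z (phaseVec d)

theorem contDiffOn_phaseDeriv {Ω : Set Total} (hΩ : IsOpen Ω) (d : ℝ) {f : Total → ℝ}
    (hf : ContDiffOn ℝ ∞ f Ω) : ContDiffOn ℝ ∞ (phaseDeriv d f) Ω :=
  contDiffOn_fderiv_apply hΩ hf _

/-- If `f` depends on the phase only, so does its derivative. -/
theorem fderiv_phaseDeriv {Ω : Set Total} (hΩ : IsOpen Ω) {n d : ℝ} (hd : d ≠ 0)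
    {f : Total → ℝ} (hf : ContDiffOn ℝ ∞ f Ω)
    (h : ∀ z ∈ Ω, ∀ b, fderiv ℝ f z b = phaseDeriv d f z * phaseForm n d b) :
    ∀ z ∈ Ω, ∀ b, fderiv ℝ (phaseDeriv d f) z b
      = phaseDeriv d (phaseDeriv d f) z * phaseForm n d b := by
  intro z hz
  have hd' := ContDiffOn.differentiableAt_of_isOpen hΩ (contDiffOn_phaseDeriv hΩ d hf) hz
  have h2 : ∀ a b, fderiv ℝ (fderiv ℝ f) z a b
      = fderiv ℝ (phaseDeriv d f) z a * phaseForm n d b := by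
    intro a b
    rw [fderiv_fderiv_eq_of_fderiv_eq hΩ hf (fun y hy => h y hy b) hz, fderiv_mul_const hd']
    simp [mul_comm]
  intro b
  have e := h2 b (phaseVec d)
  rw [phaseForm_phaseVec hd, mul_one] at e
  rw [← e, fderiv_fderiv_comm (hf.contDiffAt (hΩ.mem_nhds hz)), h2]
  rfl

/-! ### The form of the `ψ`-component. -/

namespace Coeffs

variable {K : Coeffs} {Ω : Set Total} {V : Total → Total} {n d : ℝ}

/-- The derivatives of the `u`- and `v`-components of `V` with respect to `u`: the real and
imaginary parts of the complex derivative of the `ψ`-component. -/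
def uDeriv (V : Total → Total) (α : Fin 3) (z : Total) : ℝ := fderiv ℝ (fibComp V α) z (fibVec 0)

theorem IsSymmetry.contDiffOn_uDeriv (h : K.IsSymmetry Ω V) (hΩ : IsOpen Ω) (α : Fin 3) :
    ContDiffOn ℝ ∞ (uDeriv V α) Ω :=
  contDiffOn_fderiv_apply hΩ (h.contDiffOn_fibComp α) _

/-- The fibre directions, `∂_x` and `d ∂_y - n ∂_t` span the kernel of `phaseForm`, and the
derivative vanishes on each of them. -/
theorem IsSymmetry.fderiv_uDeriv (h : K.IsSymmetry Ω V) (hΩ : IsOpen Ω)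
    (hK : K.Nondegenerate n d) {α : Fin 3} (hα : α ≠ 2) :
    ∀ z ∈ Ω, ∀ b, fderiv ℝ (uDeriv V α) z b = phaseDeriv d (uDeriv V α) z * phaseForm n d b := by
  intro z hz
  have hV := (h.contDiffOn_fibComp α).contDiffAt (hΩ.mem_nhds hz)
  have hn : fderiv ℝ (fderiv ℝ (fibComp V α)) z (fibVec 0) (d • baseVec 1 - n • baseVec 2) = 0 := by
    match α with
    | 0 => exact (h.fderiv_fderiv_null hΩ hK hz (Pi.single 0 1)).1
    | 1 => exact (h.fderiv_fderiv_null hΩ hK hz (Pi.single 0 1)).2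
    | 2 => exact absurd rfl hα
  set L := fderiv ℝ (fderiv ℝ (fibComp V α)) z (fibVec 0) with hL
  have e : ∀ b, fderiv ℝ (uDeriv V α) z b = L b := by
    intro b
    rw [hL, fderiv_fderiv_comm hV, fderiv_fderiv_apply hV]
    rfl
  have hf : ∀ β, L (fibVec β) = 0 := fun β => h.fderiv_fderiv_fib hΩ hK hz α _ _
  have hx : L (baseVec 0) = 0 := by
    rw [hL, fderiv_fderiv_comm hV]
    exact h.fderiv_fderiv_x hΩ hK hz α _
  rw [map_sub, map_smul, map_smul, smul_eq_mul, smul_eq_mul] at hn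
  intro b
  rw [phaseDeriv, e, e, map_eq_sum L b]
  simp only [Fin.sum_univ_three, hf, hx, phaseVec, map_smul, smul_eq_mul, phaseForm]
  have hd := hK.d_ne
  field_simp
  linear_combination b.1 1 * hn

/-- With `R = ∂_φ η^φ`, `A = uDeriv V 0`, `B = uDeriv V 1`, the Euler identity is `η^u = u (R - A) -
v B`. None of `R`, `A`, `B` varies with `u`, so differentiating in `u` gives `A = R - A`. -/
theorem IsSymmetry.fderiv_fibComp_two_fibVec_two (h : K.IsSymmetry Ω V) (hΩ : IsOpen Ω)
    (hK : K.Nondegenerate n d) {z : Total} (hz : z ∈ Ω) :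
    fderiv ℝ (fibComp V 2) z (fibVec 2) = 2 * uDeriv V 0 z := by
  have hR : ContDiffOn ℝ ∞ (fun y => fderiv ℝ (fibComp V 2) y (fibVec 2)) Ω :=
    contDiffOn_fderiv_apply hΩ (h.contDiffOn_fibComp 2) _
  have e : ∀ y ∈ Ω, fibComp V 0 y
      = y.2 0 * (fderiv ℝ (fibComp V 2) y (fibVec 2) - uDeriv V 0 y) - y.2 1 * uDeriv V 1 y := by
    intro y hy
    have := (h.euler hΩ hK hy).1
    simp only [uDeriv]
    linear_combination this
  have hdR := ContDiffOn.differentiableAt_of_isOpen hΩ hR hz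
  have hd0 := ContDiffOn.differentiableAt_of_isOpen hΩ (h.contDiffOn_uDeriv hΩ 0) hz
  have hd1 := ContDiffOn.differentiableAt_of_isOpen hΩ (h.contDiffOn_uDeriv hΩ 1) hz
  have A := congrArg (fun L => L (fibVec 0)) (fderiv_congr_on hΩ e hz)
  rw [fderiv_fib_mul_sub 0 1 (hdR.fun_sub hd0) hd1, fderiv_fun_sub hdR hd0,
    sub_apply, h.fderiv_uDeriv hΩ hK (by decide) z hz,
    h.fderiv_uDeriv hΩ hK (by decide) z hz, phaseForm_fibVec,
    ← fderiv_fderiv_apply ((h.contDiffOn_fibComp 2).contDiffAt (hΩ.mem_nhds hz))] at A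
  have hff : fderiv ℝ (fderiv ℝ (fibComp V 2)) z (fibVec 0) (fibVec 2) = 0 :=
    h.fderiv_fderiv_fib hΩ hK hz 2 _ _
  rw [hff] at A
  change uDeriv V 0 z = _ at A
  simp [fibVec] at A
  simp only [fibVec]
  linear_combination -A

/-- The Euler identities exclude an inhomogeneous term, so that `η^u + i η^v = (u + i v) (A + i B)`.
-/
theorem IsSymmetry.fibComp_eq (h : K.IsSymmetry Ω V) (hΩ : IsOpen Ω)
    (hK : K.Nondegenerate n d) {z : Total} (hz : z ∈ Ω) :
    fibComp V 0 z = z.2 0 * uDeriv V 0 z - z.2 1 * uDeriv V 1 z ∧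
    fibComp V 1 z = z.2 1 * uDeriv V 0 z + z.2 0 * uDeriv V 1 z := by
  obtain ⟨-, h1, h2⟩ := h.cauchyRiemann hΩ hK hz
  have A := h.euler hΩ hK hz
  rw [h1, h2, h.fderiv_fibComp_two_fibVec_two hΩ hK hz] at A
  simp only [uDeriv] at A ⊢
  exact ⟨by linear_combination A.1, by linear_combination A.2⟩

theorem IsSymmetry.fderiv_fibComp_horizontal (h : K.IsSymmetry Ω V) (hΩ : IsOpen Ω)
    (hK : K.Nondegenerate n d) {z : Total} (hz : z ∈ Ω) (i : Fin 3) :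
    fderiv ℝ (fibComp V 0) z (baseVec i) = (z.2 0 * phaseDeriv d (uDeriv V 0) z
      - z.2 1 * phaseDeriv d (uDeriv V 1) z) * phaseForm n d (baseVec i) ∧
    fderiv ℝ (fibComp V 1) z (baseVec i) = (z.2 1 * phaseDeriv d (uDeriv V 0) z
      + z.2 0 * phaseDeriv d (uDeriv V 1) z) * phaseForm n d (baseVec i) := by
  have hd0 := ContDiffOn.differentiableAt_of_isOpen hΩ (h.contDiffOn_uDeriv hΩ 0) hz
  have hd1 := ContDiffOn.differentiableAt_of_isOpen hΩ (h.contDiffOn_uDeriv hΩ 1) hz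
  rw [fderiv_congr_on hΩ (fun y hy => (h.fibComp_eq hΩ hK hy).1) hz,
    fderiv_congr_on hΩ (fun y hy => (h.fibComp_eq hΩ hK hy).2) hz,
    fderiv_fib_mul_sub 0 1 hd0 hd1, fderiv_fib_mul_add 1 0 hd0 hd1,
    h.fderiv_uDeriv hΩ hK (by decide) z hz, h.fderiv_uDeriv hΩ hK (by decide) z hz]
  simp only [show ∀ α, (baseVec i).2 α = 0 from fun α => rfl]
  constructor <;> ring

theorem IsSymmetry.fderiv_fderiv_fibComp_horizontal (h : K.IsSymmetry Ω V) (hΩ : IsOpen Ω)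
    (hK : K.Nondegenerate n d) {z : Total} (hz : z ∈ Ω) (i j : Fin 3) :
    fderiv ℝ (fderiv ℝ (fibComp V 0)) z (baseVec i) (baseVec j)
      = (z.2 0 * phaseDeriv d (phaseDeriv d (uDeriv V 0)) z
        - z.2 1 * phaseDeriv d (phaseDeriv d (uDeriv V 1)) z)
          * (phaseForm n d (baseVec i) * phaseForm n d (baseVec j)) ∧
    fderiv ℝ (fderiv ℝ (fibComp V 1)) z (baseVec i) (baseVec j)
      = (z.2 1 * phaseDeriv d (phaseDeriv d (uDeriv V 0)) z
        + z.2 0 * phaseDeriv d (phaseDeriv d (uDeriv V 1)) z)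
          * (phaseForm n d (baseVec i) * phaseForm n d (baseVec j)) := by
  have hs0 := contDiffOn_phaseDeriv hΩ d (h.contDiffOn_uDeriv hΩ 0)
  have hs1 := contDiffOn_phaseDeriv hΩ d (h.contDiffOn_uDeriv hΩ 1)
  have hd0 := ContDiffOn.differentiableAt_of_isOpen hΩ hs0 hz
  have hd1 := ContDiffOn.differentiableAt_of_isOpen hΩ hs1 hz
  have p0 := fderiv_phaseDeriv hΩ hK.d_ne (h.contDiffOn_uDeriv hΩ 0)
    (h.fderiv_uDeriv hΩ hK (by decide)) z hz
  have p1 := fderiv_phaseDeriv hΩ hK.d_ne (h.contDiffOn_uDeriv hΩ 1)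
    (h.fderiv_uDeriv hΩ hK (by decide)) z hz
  have hd : ∀ α β : Fin 3, DifferentiableAt ℝ (fun z : Total =>
      z.2 α * phaseDeriv d (uDeriv V 0) z) z ∧ DifferentiableAt ℝ (fun z : Total =>
      z.2 β * phaseDeriv d (uDeriv V 1) z) z := fun α β =>
    ⟨(hasFDerivAt_fib α z).differentiableAt.fun_mul hd0,
      (hasFDerivAt_fib β z).differentiableAt.fun_mul hd1⟩
  rw [fderiv_fderiv_eq_of_fderiv_eq hΩ (h.contDiffOn_fibComp 0)
      (fun y hy => (h.fderiv_fibComp_horizontal hΩ hK hy j).1) hz,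
    fderiv_fderiv_eq_of_fderiv_eq hΩ (h.contDiffOn_fibComp 1)
      (fun y hy => (h.fderiv_fibComp_horizontal hΩ hK hy j).2) hz,
    fderiv_mul_const ((hd 0 1).1.fun_sub (hd 0 1).2),
    fderiv_mul_const ((hd 1 0).1.fun_add (hd 1 0).2), smul_apply, smul_apply,
    fderiv_fib_mul_sub 0 1 hd0 hd1, fderiv_fib_mul_add 1 0 hd0 hd1, p0, p1]
  simp only [show ∀ α, (baseVec i).2 α = 0 from fun α => rfl, smul_eq_mul]
  constructor <;> ring

/-- The equations that come from the jets with vanishing first derivatives. -/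
theorem IsSymmetry.zero_order (h : K.IsSymmetry Ω V) (hΩ : IsOpen Ω)
    (hK : K.Nondegenerate n d) {z : Total} (hz : z ∈ Ω) :
    -(K.a₁ * d + K.a₅ * n) * (z.2 1 * phaseDeriv d (uDeriv V 0) z
        + z.2 0 * phaseDeriv d (uDeriv V 1) z)
      - 2 * K.κ * uDeriv V 0 z * (z.2 0 ^ 2 + z.2 1 ^ 2) * z.2 0
      + K.w * z.2 0 * fibComp V 2 z = 0 ∧
    (K.a₁ * d + K.a₅ * n) * (z.2 0 * phaseDeriv d (uDeriv V 0) z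
        - z.2 1 * phaseDeriv d (uDeriv V 1) z)
      - 2 * K.κ * uDeriv V 0 z * (z.2 0 ^ 2 + z.2 1 ^ 2) * z.2 1
      + K.w * z.2 1 * fibComp V 2 z = 0 ∧
    fderiv ℝ (fderiv ℝ (fibComp V 2)) z (baseVec 0) (baseVec 0)
      + K.σ * (fderiv ℝ (fderiv ℝ (fibComp V 2)) z (baseVec 1) (baseVec 1)
        - fderiv ℝ (fderiv ℝ (fibComp V 2)) z (baseVec 2) (baseVec 2))
      - 2 * (z.2 0 * fderiv ℝ (fderiv ℝ (fibComp V 0)) z (baseVec 1) (baseVec 1)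
        + z.2 1 * fderiv ℝ (fderiv ℝ (fibComp V 1)) z (baseVec 1) (baseVec 1)) = 0 := by
  have hφ := h.fderiv_fibVec_two hΩ hK hz
  have hφ2 := h.fderiv_fibComp_two hΩ hK hz
  obtain ⟨hμ, hc1, hc2⟩ := h.cauchyRiemann hΩ hK hz
  have A := h.low hΩ hK.a_ne hz 0
  have hp : ∀ f₁ α, K.particular z.2 f₁ 0 0 α =
    ![(K.opQ f₁ 1 + K.κ * (z.2 0 ^ 2 + z.2 1 ^ 2) * z.2 0 - K.w * z.2 0 * z.2 2) / K.a,
      (-K.opQ f₁ 0 + K.κ * (z.2 0 ^ 2 + z.2 1 ^ 2) * z.2 1 - K.w * z.2 1 * z.2 2) / K.a,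
      2 * (f₁ 1 0 ^ 2 + f₁ 1 1 ^ 2)] α := fun f₁ α => by simp [particular]
  have hp1 : ∀ f₁, K.particular z.2 f₁ 1 1 = 0 := fun f₁ => by simp [particular]
  have hp2 : ∀ f₁, K.particular z.2 f₁ 2 2 = 0 := fun f₁ => by simp [particular]
  have hp3 : ∀ f₁, K.particular z.2 f₁ 2 1 = 0 := fun f₁ => by simp [particular]
  have hp4 : ∀ f₁, K.particular z.2 f₁ 1 2 = 0 := fun f₁ => by simp [particular]
  simp only [linRe, linIm, linWave, opP, h.low_expand hΩ hK hz, h.first_expand hΩ hK hz,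
    h.top_expand hΩ hK hz, map_fib _ (K.particular _ _ _ _), hp, hp1, hp2, hp3, hp4, hφ, hφ2]
    at A
  simp [mk_zero_zero, opQ, hμ, hc1, hc2] at A
  obtain ⟨A0, A1, A2⟩ := A
  have ha := hK.a_ne
  have hn := hK.null_n
  have hd := hK.null_d
  have s0 : phaseForm n d (baseVec 0) = 0 := by simp [phaseForm, baseVec]
  have s1 : phaseForm n d (baseVec 1) = n := by simp [phaseForm, baseVec]
  have s2 : phaseForm n d (baseVec 2) = d := by simp [phaseForm, baseVec]
  obtain ⟨f0, f1⟩ := h.fibComp_eq hΩ hK hz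
  have g := h.fderiv_fibComp_horizontal hΩ hK hz
  have g' := h.fderiv_fderiv_fibComp_horizontal hΩ hK hz
  have q0 : fderiv ℝ (fibComp V 0) z (fibVec 0) = uDeriv V 0 z := rfl
  have q1 : fderiv ℝ (fibComp V 1) z (fibVec 0) = uDeriv V 1 z := rfl
  simp only [(g _).1, (g _).2, (g' _ _).1, (g' _ _).2, s0, s1, s2, f0, f1, q0, q1] at A0 A1
  field_simp at A0 A1
  refine ⟨?_, ?_, by linear_combination A2⟩
  -- The second phase derivatives of `A` and `B` come with the factor `a₂ n² + a₄ n d + a₃ d² = (n *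
  -- hn + d * hd) / 2 = 0`.
  · linear_combination A0 - (z.2 0 * phaseDeriv d (phaseDeriv d (uDeriv V 0)) z
        - z.2 1 * phaseDeriv d (phaseDeriv d (uDeriv V 1)) z) / 2 * (n * hn + d * hd)
  · linear_combination A1 - (z.2 1 * phaseDeriv d (phaseDeriv d (uDeriv V 0)) z
        + z.2 0 * phaseDeriv d (phaseDeriv d (uDeriv V 1)) z) / 2 * (n * hn + d * hd)

end Coeffs

/-! ### The candidate fields: translations and phase-dependent rotations. -/

theorem hasFDerivAt_base (i : Fin 3) (z : Total) :
    HasFDerivAt (fun z : Total => z.1 i)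
      ((ContinuousLinearMap.proj (R := ℝ) (φ := fun _ : Fin 3 => ℝ) i).comp
        (ContinuousLinearMap.fst ℝ Base Fib)) z :=
  ((ContinuousLinearMap.proj (R := ℝ) (φ := fun _ : Fin 3 => ℝ) i).comp
    (ContinuousLinearMap.fst ℝ Base Fib)).hasFDerivAt

theorem contDiff_phaseForm (n d : ℝ) : ContDiff ℝ ∞ (phaseForm n d) := by
  unfold phaseForm
  fun_prop

theorem fderiv_phaseForm (n d : ℝ) (z b : Total) :
    fderiv ℝ (phaseForm n d) z b = phaseForm n d b := by
  have h := ((hasFDerivAt_base 2 z).const_mul d).add ((hasFDerivAt_base 1 z).const_mul n)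
  change fderiv ℝ (fun z : Total => d * z.1 2 + n * z.1 1) z b = _
  erw [h.fderiv]
  simp [phaseForm]

/-- A quadratic polynomial of the phase. -/
def phasePoly (n d c₀ c₁ c₂ : ℝ) (z : Total) : ℝ :=
  c₀ + c₁ * phaseForm n d z + c₂ * phaseForm n d z ^ 2

theorem contDiff_phasePoly (n d c₀ c₁ c₂ : ℝ) : ContDiff ℝ ∞ (phasePoly n d c₀ c₁ c₂) := by
  unfold phasePoly
  have := contDiff_phaseForm n d
  fun_prop

theorem fderiv_phasePoly (n d c₀ c₁ c₂ : ℝ) (z b : Total) :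
    fderiv ℝ (phasePoly n d c₀ c₁ c₂) z b
      = phasePoly n d c₁ (2 * c₂) 0 z * phaseForm n d b := by
  have hs := ((contDiff_phaseForm n d).differentiable (by simp) z).hasFDerivAt
  have h := ((hs.const_mul c₁).const_add c₀).add ((hs.pow 2).const_mul c₂)
  change fderiv ℝ (fun z => c₀ + c₁ * phaseForm n d z + c₂ * phaseForm n d z ^ 2) z b = _
  erw [h.fderiv]
  simp [phasePoly, fderiv_phaseForm]
  ring

/-- The combination of a translation and a phase rotation by a quadratic polynomial of the phase. -/
def symField (n d k : ℝ) (x : Base) (c₀ c₁ c₂ : ℝ) (z : Total) : Total :=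
  (x, ![-(z.2 1 * phasePoly n d c₀ c₁ c₂ z), z.2 0 * phasePoly n d c₀ c₁ c₂ z,
    k * phasePoly n d c₁ (2 * c₂) 0 z])

section SymField

variable (n d k : ℝ) (x : Base) (c₀ c₁ c₂ : ℝ)

theorem contDiff_symField : ContDiff ℝ ∞ (symField n d k x c₀ c₁ c₂) := by
  have h1 := contDiff_phasePoly n d c₀ c₁ c₂
  have h2 := contDiff_phasePoly n d c₁ (2 * c₂) 0
  refine contDiff_const.prodMk (contDiff_pi.2 fun i => ?_)
  match i with
  | 0 => change ContDiff ℝ ∞ fun z : Total => -(z.2 1 * phasePoly n d c₀ c₁ c₂ z); fun_prop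
  | 1 => change ContDiff ℝ ∞ fun z : Total => z.2 0 * phasePoly n d c₀ c₁ c₂ z; fun_prop
  | 2 => change ContDiff ℝ ∞ fun z : Total => k * phasePoly n d c₁ (2 * c₂) 0 z; fun_prop

theorem fderiv_fib_mul (α : Fin 3) {F : Total → ℝ} {z : Total}
    (hF : DifferentiableAt ℝ F z) (b : Total) :
    fderiv ℝ (fun z => z.2 α * F z) z b = b.2 α * F z + z.2 α * fderiv ℝ F z b := by
  have h := (hasFDerivAt_fib α z).mul hF.hasFDerivAt
  erw [h.fderiv]
  simp
  ring

theorem fderiv_baseComp_symField (i : Fin 3) :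
    fderiv ℝ (baseComp (symField n d k x c₀ c₁ c₂) i) = 0 := by
  change fderiv ℝ (fun _ => x i) = 0
  simp

theorem differentiable_phasePoly : Differentiable ℝ (phasePoly n d c₀ c₁ c₂) :=
  (contDiff_phasePoly n d c₀ c₁ c₂).differentiable (by simp)

theorem fderiv_fibComp_symField_zero (z b : Total) :
    fderiv ℝ (fibComp (symField n d k x c₀ c₁ c₂) 0) z b
      = -(b.2 1 * phasePoly n d c₀ c₁ c₂ z
        + z.2 1 * (phasePoly n d c₁ (2 * c₂) 0 z * phaseForm n d b)) := by
  change fderiv ℝ (fun z : Total => -(z.2 1 * phasePoly n d c₀ c₁ c₂ z)) z b = _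
  rw [fderiv_fun_neg, neg_apply, fderiv_fib_mul 1 (differentiable_phasePoly _ _ _ _ _ z),
    fderiv_phasePoly]

theorem fderiv_fibComp_symField_one (z b : Total) :
    fderiv ℝ (fibComp (symField n d k x c₀ c₁ c₂) 1) z b
      = b.2 0 * phasePoly n d c₀ c₁ c₂ z
        + z.2 0 * (phasePoly n d c₁ (2 * c₂) 0 z * phaseForm n d b) := by
  change fderiv ℝ (fun z : Total => z.2 0 * phasePoly n d c₀ c₁ c₂ z) z b = _
  rw [fderiv_fib_mul 0 (differentiable_phasePoly _ _ _ _ _ z), fderiv_phasePoly]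

theorem fderiv_fibComp_symField_two (z b : Total) :
    fderiv ℝ (fibComp (symField n d k x c₀ c₁ c₂) 2) z b
      = k * (2 * c₂) * phaseForm n d b := by
  change fderiv ℝ (fun z : Total => k * phasePoly n d c₁ (2 * c₂) 0 z) z b = _
  rw [fderiv_const_mul (differentiable_phasePoly _ _ _ _ _ z), smul_apply, fderiv_phasePoly]
  simp [phasePoly]
  ring

theorem fderiv_fderiv_fibComp_symField_zero (z a b : Total) :
    fderiv ℝ (fderiv ℝ (fibComp (symField n d k x c₀ c₁ c₂) 0)) z a b
      = -(b.2 1 * (phasePoly n d c₁ (2 * c₂) 0 z * phaseForm n d a)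
        + a.2 1 * phasePoly n d c₁ (2 * c₂) 0 z * phaseForm n d b
        + z.2 1 * (2 * c₂) * phaseForm n d a * phaseForm n d b) := by
  have hV := contDiffAt_fibComp (contDiff_symField n d k x c₀ c₁ c₂).contDiffAt (z := z) 0
  rw [fderiv_fderiv_apply hV]
  have e : (fun y => fderiv ℝ (fibComp (symField n d k x c₀ c₁ c₂) 0) y b)
      = fun y : Total => -(b.2 1 * phasePoly n d c₀ c₁ c₂ y
        + y.2 1 * phasePoly n d c₁ (2 * c₂) 0 y * phaseForm n d b) := by
    funext y
    rw [fderiv_fibComp_symField_zero]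
    ring
  have hp := differentiable_phasePoly n d c₀ c₁ c₂ z
  have hp' := differentiable_phasePoly n d c₁ (2 * c₂) 0 z
  have hq := (hasFDerivAt_fib 1 z).differentiableAt.fun_mul hp'
  rw [e, fderiv_fun_neg, neg_apply, fderiv_fun_add (hp.const_mul _) (hq.mul_const _),
    add_apply, fderiv_const_mul hp, fderiv_mul_const hq, smul_apply, smul_apply, fderiv_phasePoly,
    fderiv_fib_mul 1 hp', fderiv_phasePoly]
  simp only [smul_eq_mul, phasePoly]
  ring

theorem fderiv_fderiv_fibComp_symField_one (z a b : Total) :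
    fderiv ℝ (fderiv ℝ (fibComp (symField n d k x c₀ c₁ c₂) 1)) z a b
      = b.2 0 * (phasePoly n d c₁ (2 * c₂) 0 z * phaseForm n d a)
        + a.2 0 * phasePoly n d c₁ (2 * c₂) 0 z * phaseForm n d b
        + z.2 0 * (2 * c₂) * phaseForm n d a * phaseForm n d b := by
  have hV := contDiffAt_fibComp (contDiff_symField n d k x c₀ c₁ c₂).contDiffAt (z := z) 1
  rw [fderiv_fderiv_apply hV]
  have e : (fun y => fderiv ℝ (fibComp (symField n d k x c₀ c₁ c₂) 1) y b)
      = fun y : Total => b.2 0 * phasePoly n d c₀ c₁ c₂ y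
        + y.2 0 * phasePoly n d c₁ (2 * c₂) 0 y * phaseForm n d b := by
    funext y
    rw [fderiv_fibComp_symField_one]
    ring
  have hp := differentiable_phasePoly n d c₀ c₁ c₂ z
  have hp' := differentiable_phasePoly n d c₁ (2 * c₂) 0 z
  have hq := (hasFDerivAt_fib 0 z).differentiableAt.fun_mul hp'
  rw [e, fderiv_fun_add (hp.const_mul _) (hq.mul_const _),
    add_apply, fderiv_const_mul hp, fderiv_mul_const hq, smul_apply, smul_apply, fderiv_phasePoly,
    fderiv_fib_mul 0 hp', fderiv_phasePoly]
  simp only [smul_eq_mul, phasePoly]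
  ring

theorem fderiv_fderiv_fibComp_symField_two (z a b : Total) :
    fderiv ℝ (fderiv ℝ (fibComp (symField n d k x c₀ c₁ c₂) 2)) z a b = 0 := by
  have hV := contDiffAt_fibComp (contDiff_symField n d k x c₀ c₁ c₂).contDiffAt (z := z) 2
  rw [fderiv_fderiv_apply hV]
  simp [fderiv_fibComp_symField_two]

theorem fderiv_symField (z b : Total) : fderiv ℝ (symField n d k x c₀ c₁ c₂) z b
    = (0, ![-(b.2 1 * phasePoly n d c₀ c₁ c₂ z
        + z.2 1 * (phasePoly n d c₁ (2 * c₂) 0 z * phaseForm n d b)),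
      b.2 0 * phasePoly n d c₀ c₁ c₂ z
        + z.2 0 * (phasePoly n d c₁ (2 * c₂) 0 z * phaseForm n d b),
      k * (2 * c₂) * phaseForm n d b]) := by
  have hV := (contDiff_symField n d k x c₀ c₁ c₂).contDiffAt (x := z)
  refine Prod.ext (funext fun i => ?_) (funext fun i => ?_)
  · rw [fderiv_fst_apply hV, fderiv_baseComp_symField]
    rfl
  · rw [fderiv_snd_apply hV]
    match i with
    | 0 => rw [fderiv_fibComp_symField_zero]; rfl
    | 1 => rw [fderiv_fibComp_symField_one]; rfl
    | 2 => rw [fderiv_fibComp_symField_two]; rfl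

/-- The rotations with phase-dependent coefficients commute with each other, and a translation by
`x` differentiates the polynomial in the phase with factor `phaseForm n d (x, 0)`. Its degree drops,
so no quadratic term is left. -/
theorem lieBracket_symField (x' : Base) (c₀' c₁' c₂' : ℝ) :
    VectorField.lieBracket ℝ (symField n d k x c₀ c₁ c₂) (symField n d k x' c₀' c₁' c₂')
      = symField n d k 0 (phaseForm n d (x, 0) * c₁' - phaseForm n d (x', 0) * c₁)
          (2 * (phaseForm n d (x, 0) * c₂' - phaseForm n d (x', 0) * c₂)) 0 := by
  funext z
  rw [VectorField.lieBracket, fderiv_symField, fderiv_symField]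
  refine Prod.ext ?_ (funext fun i => ?_)
  · simp [symField]
  · match i with
    | 0 => simp [symField, phasePoly, phaseForm]; ring
    | 1 => simp [symField, phasePoly, phaseForm]; ring
    | 2 => simp [symField, phasePoly, phaseForm]; ring

end SymField

/-! ### The symmetries are exactly these fields. -/

namespace Coeffs

variable {K : Coeffs} {Ω : Set Total} {V : Total → Total} {n d : ℝ}

/-- The prolongation at `z` depends only on the germ of the field there. -/
theorem IsSymmetry.congr (h : K.IsSymmetry Ω V) (hΩ : IsOpen Ω) {W : Total → Total}
    (hW : ∀ z ∈ Ω, W z = V z) : K.IsSymmetry Ω W := by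
  refine ⟨h.1.congr hW, fun z hz f₁ f₂ => ?_⟩
  have e : W =ᶠ[𝓝 z] V := Filter.eventually_of_mem (hΩ.mem_nhds hz) hW
  have : prolongationAt W z f₁ f₂ = prolongationAt V z f₁ f₂ := by
    simp only [prolongationAt, hW z hz, e.fderiv_eq, e.fderiv.fderiv_eq]
  rw [this]
  exact h.2 z hz f₁ f₂

/-- The rotation by `A` turns the real and imaginary equations into multiples of each other.
Derivatives of `A` meet the null covector and drop out, except for the drift term, which the
`φ`-component cancels: this fixes the factor `(a₁ d + a₅ n) / w`. -/
theorem isSymmetry_symField (hK : K.Nondegenerate n d) (Ω : Set Total) (x : Base) (c₀ c₁ c₂ : ℝ) :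
    K.IsSymmetry Ω (symField n d ((K.a₁ * d + K.a₅ * n) / K.w) x c₀ c₁ c₂) := by
  have hC := contDiff_symField n d ((K.a₁ * d + K.a₅ * n) / K.w) x c₀ c₁ c₂
  refine ⟨hC.contDiffOn, fun z _ f₁ f₂ hs h0 h1 h2 => ?_⟩
  have hn := hK.null_n
  have hd := hK.null_d
  have hw : K.w * ((K.a₁ * d + K.a₅ * n) / K.w) = K.a₁ * d + K.a₅ * n := by
    field_simp [hK.w_ne]
  set k := (K.a₁ * d + K.a₅ * n) / K.w
  set A := phasePoly n d c₀ c₁ c₂ z with hA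
  set A' := phasePoly n d c₁ (2 * c₂) 0 z with hA'
  have hf0 : fibComp (symField n d k x c₀ c₁ c₂) 0 z = -(z.2 1 * A) := rfl
  have hf1 : fibComp (symField n d k x c₀ c₁ c₂) 1 z = z.2 0 * A := rfl
  have hf2 : fibComp (symField n d k x c₀ c₁ c₂) 2 z = k * A' := rfl
  have s0 : ∀ r : Fib, phaseForm n d (Pi.single 0 1, r) = 0 := fun r => by simp [phaseForm]
  have s1 : ∀ r : Fib, phaseForm n d (Pi.single 1 1, r) = n := fun r => by simp [phaseForm]
  have s2 : ∀ r : Fib, phaseForm n d (Pi.single 2 1, r) = d := fun r => by simp [phaseForm]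
  have s3 : ∀ r : Fib, phaseForm n d (0, r) = 0 := fun r => by simp [phaseForm]
  rw [prolongationAt_eq hC.contDiffAt]
  simp only [eqRe, eqIm, eqWave, linRe, linIm, linWave, opP, opQ, hf0, hf1, hf2, firstPart,
    lowPart, topPart, fderiv_baseComp_symField, fderiv_fibComp_symField_zero,
    fderiv_fibComp_symField_one, fderiv_fibComp_symField_two, fderiv_fderiv_fibComp_symField_zero,
    fderiv_fderiv_fibComp_symField_one, fderiv_fderiv_fibComp_symField_two, ← hA, ← hA',
    s0, s1, s2, s3] at h0 h1 h2 ⊢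
  simp
  refine ⟨?_, ?_, ?_⟩
  · linear_combination -A * h1 - A' * (f₁ 1 1 * hn + f₁ 2 1 * hd) - z.2 1 * c₂ * (n * hn + d * hd)
      + z.2 0 * A' * hw
  · linear_combination A * h0 + A' * (f₁ 1 0 * hn + f₁ 2 0 * hd) + z.2 0 * c₂ * (n * hn + d * hd)
      + z.2 1 * A' * hw
  · ring

/-- `u` times the imaginary equation of `zero_order` minus `v` times the real one leaves `(a₁ d + a₅
n) (u² + v²) A'`. -/
theorem IsSymmetry.phaseDeriv_uDeriv (h : K.IsSymmetry Ω V) (hΩ : IsOpen Ω)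
    (hK : K.Nondegenerate n d) : ∀ z ∈ Ω, phaseDeriv d (uDeriv V 0) z = 0 := by
  refine eq_zero_of_fib_ne_zero hΩ 0
    (contDiffOn_phaseDeriv hΩ d (h.contDiffOn_uDeriv hΩ 0)).continuousOn fun z hz hu => ?_
  obtain ⟨h0, h1, -⟩ := h.zero_order hΩ hK hz
  have hp : z.2 0 ^ 2 + z.2 1 ^ 2 ≠ 0 := by positivity
  refine (mul_eq_zero.1 (?_ : ((K.a₁ * d + K.a₅ * n) * (z.2 0 ^ 2 + z.2 1 ^ 2)) * _ = 0)).resolve_left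
    (mul_ne_zero hK.drift hp)
  linear_combination z.2 0 * h1 - z.2 1 * h0

/-- The complementary combination, `u` times the real plus `v` times the imaginary equation,
determines `η^φ`. -/
theorem IsSymmetry.w_mul_fibComp_two (h : K.IsSymmetry Ω V) (hΩ : IsOpen Ω)
    (hK : K.Nondegenerate n d) : ∀ z ∈ Ω, K.w * fibComp V 2 z
      - (2 * K.κ * uDeriv V 0 z * (z.2 0 ^ 2 + z.2 1 ^ 2)
        + (K.a₁ * d + K.a₅ * n) * phaseDeriv d (uDeriv V 1) z) = 0 := by
  refine eq_zero_of_fib_ne_zero hΩ 0 ?_ fun z hz hu => ?_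
  · have c1 := (h.contDiffOn_fibComp 2).continuousOn
    have c2 := (contDiffOn_phaseDeriv hΩ d (h.contDiffOn_uDeriv hΩ 1)).continuousOn
    have c3 := (h.contDiffOn_uDeriv hΩ 0).continuousOn
    fun_prop
  obtain ⟨h0, h1, -⟩ := h.zero_order hΩ hK hz
  have hp : z.2 0 ^ 2 + z.2 1 ^ 2 ≠ 0 := by positivity
  refine (mul_eq_zero.1 (?_ : (z.2 0 ^ 2 + z.2 1 ^ 2) * _ = 0)).resolve_left hp
  linear_combination z.2 0 * h0 + z.2 1 * h1

/-- `∂_φ η^φ = 2 A`, while the formula just found for `η^φ` does not involve `φ`. The argument does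
not depend on `κ`, which may be zero. -/
theorem IsSymmetry.uDeriv_zero (h : K.IsSymmetry Ω V) (hΩ : IsOpen Ω)
    (hK : K.Nondegenerate n d) {z : Total} (hz : z ∈ Ω) : uDeriv V 0 z = 0 := by
  have e : ∀ y ∈ Ω, fibComp V 2 y = (2 * K.κ / K.w) * (y.2 0 * (y.2 0 * uDeriv V 0 y)
      + y.2 1 * (y.2 1 * uDeriv V 0 y))
      + ((K.a₁ * d + K.a₅ * n) / K.w) * phaseDeriv d (uDeriv V 1) y := by
    intro y hy
    have hw := hK.w_ne
    field_simp
    linear_combination h.w_mul_fibComp_two hΩ hK y hy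
  have hd0 := ContDiffOn.differentiableAt_of_isOpen hΩ (h.contDiffOn_uDeriv hΩ 0) hz
  have hd1 := ContDiffOn.differentiableAt_of_isOpen hΩ
    (contDiffOn_phaseDeriv hΩ d (h.contDiffOn_uDeriv hΩ 1)) hz
  have p0 : ∀ b, fderiv ℝ (uDeriv V 0) z b = 0 := fun b => by
    rw [h.fderiv_uDeriv hΩ hK (by decide) z hz, h.phaseDeriv_uDeriv hΩ hK z hz, zero_mul]
  have p1 := fderiv_phaseDeriv hΩ hK.d_ne (h.contDiffOn_uDeriv hΩ 1)
    (h.fderiv_uDeriv hΩ hK (by decide)) z hz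
  have e0 := (hasFDerivAt_fib 0 z).differentiableAt.fun_mul hd0
  have e1 := (hasFDerivAt_fib 1 z).differentiableAt.fun_mul hd0
  have e2 := ((hasFDerivAt_fib 0 z).differentiableAt.fun_mul e0).fun_add
    ((hasFDerivAt_fib 1 z).differentiableAt.fun_mul e1)
  have A := h.fderiv_fibComp_two_fibVec_two hΩ hK hz
  rw [fderiv_congr_on hΩ e hz, fderiv_fun_add (e2.const_mul _) (hd1.const_mul _), add_apply,
    fderiv_const_mul e2, fderiv_const_mul hd1, smul_apply, smul_apply, p1, phaseForm_fibVec,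
    fderiv_fib_mul_add 0 1 e0 e1, fderiv_fib_mul 0 hd0, fderiv_fib_mul 1 hd0, p0] at A
  simp [fibVec] at A
  exact A

/-- `η^φ` is a nonzero multiple of `B'`, and a rotation by `B` leaves `|ψ|²` unchanged; the wave
equation thus reduces to a multiple of `σ (n² - d²) B''' = 0`. -/
theorem IsSymmetry.third_phaseDeriv (h : K.IsSymmetry Ω V) (hΩ : IsOpen Ω)
    (hK : K.Nondegenerate n d) {z : Total} (hz : z ∈ Ω) :
    phaseDeriv d (phaseDeriv d (phaseDeriv d (uDeriv V 1))) z = 0 := by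
  have e : ∀ y ∈ Ω, fibComp V 2 y
      = ((K.a₁ * d + K.a₅ * n) / K.w) * phaseDeriv d (uDeriv V 1) y := by
    intro y hy
    have hw := hK.w_ne
    have := h.w_mul_fibComp_two hΩ hK y hy
    rw [h.uDeriv_zero hΩ hK hy] at this
    field_simp
    linear_combination this
  have c0 := h.contDiffOn_uDeriv hΩ 1
  have c1 := contDiffOn_phaseDeriv hΩ d c0
  have c2 := contDiffOn_phaseDeriv hΩ d c1
  have p1 := fderiv_phaseDeriv hΩ hK.d_ne c0 (h.fderiv_uDeriv hΩ hK (by decide))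
  have p2 := fderiv_phaseDeriv hΩ hK.d_ne c1 p1
  have f1 : ∀ b, ∀ y ∈ Ω, fderiv ℝ (fibComp V 2) y b = ((K.a₁ * d + K.a₅ * n) / K.w)
      * phaseDeriv d (phaseDeriv d (uDeriv V 1)) y * phaseForm n d b := by
    intro b y hy
    rw [fderiv_congr_on hΩ e hy,
      fderiv_const_mul (ContDiffOn.differentiableAt_of_isOpen hΩ c1 hy), smul_apply, p1 y hy,
      smul_eq_mul, mul_assoc]
  have f2 : ∀ a b, fderiv ℝ (fderiv ℝ (fibComp V 2)) z a b = ((K.a₁ * d + K.a₅ * n) / K.w)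
      * phaseDeriv d (phaseDeriv d (phaseDeriv d (uDeriv V 1))) z
      * (phaseForm n d a * phaseForm n d b) := by
    intro a b
    have hd2 := ContDiffOn.differentiableAt_of_isOpen hΩ c2 hz
    rw [fderiv_fderiv_eq_of_fderiv_eq hΩ (h.contDiffOn_fibComp 2) (f1 b) hz,
      fderiv_mul_const (hd2.const_mul _), fderiv_const_mul hd2, smul_apply, smul_apply, p2 z hz]
    simp only [smul_eq_mul]
    ring
  have g := h.fderiv_fderiv_fibComp_horizontal hΩ hK hz 1 1
  have A := (h.zero_order hΩ hK hz).2.2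
  have u0 : phaseDeriv d (phaseDeriv d (uDeriv V 0)) z = 0 :=
    fderiv_eq_zero_on hΩ (h.phaseDeriv_uDeriv hΩ hK) hz _
  have s0 : phaseForm n d (baseVec 0) = 0 := by simp [phaseForm, baseVec]
  have s1 : phaseForm n d (baseVec 1) = n := by simp [phaseForm, baseVec]
  have s2 : phaseForm n d (baseVec 2) = d := by simp [phaseForm, baseVec]
  rw [g.1, g.2, f2, f2, f2, u0, s0, s1, s2] at A
  refine (mul_eq_zero.1 (?_ : (K.σ * (n ^ 2 - d ^ 2) * ((K.a₁ * d + K.a₅ * n) / K.w)) * _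
    = 0)).resolve_left (mul_ne_zero (mul_ne_zero hK.σ_ne hK.sq_sub_sq)
      (div_ne_zero hK.drift hK.w_ne))
  linear_combination A

theorem exists_eq_const_of_fderiv {Ω : Set Total} (hΩ : IsOpen Ω) (hc : IsConnected Ω)
    {f : Total → ℝ} (hf : ContDiffOn ℝ ∞ f Ω) (h : ∀ z ∈ Ω, ∀ b, fderiv ℝ f z b = 0) :
    ∃ c, ∀ z ∈ Ω, f z = c := by
  obtain ⟨z₀, hz₀⟩ := hc.nonempty
  refine ⟨f z₀, fun z hz => ?_⟩
  exact hΩ.is_const_of_fderiv_eq_zero hc.isPreconnected (hf.differentiableOn (by simp))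
    (fun y hy => ContinuousLinearMap.ext fun b => h y hy b) hz hz₀

/-- On a connected open set every symmetry is a `symField`. -/
theorem IsSymmetry.exists_eq_symField (h : K.IsSymmetry Ω V) (hΩ : IsOpen Ω)
    (hc : IsConnected Ω) (hK : K.Nondegenerate n d) : ∃ (x : Base) (c₀ c₁ c₂ : ℝ),
      ∀ z ∈ Ω, V z = symField n d ((K.a₁ * d + K.a₅ * n) / K.w) x c₀ c₁ c₂ z := by
  have hx : ∀ k, ∃ x, ∀ z ∈ Ω, baseComp V k z = x := fun k =>
    exists_eq_const_of_fderiv hΩ hc (h.contDiffOn_baseComp k) fun z hz b => by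
      rw [h.fderiv_baseComp hΩ hK hz, (h.cauchyRiemann hΩ hK hz).1, zero_mul]
  choose x hx using hx
  have k0 := h.contDiffOn_uDeriv hΩ 1
  have k1 := contDiffOn_phaseDeriv hΩ d k0
  have k2 := contDiffOn_phaseDeriv hΩ d k1
  have p0 := h.fderiv_uDeriv hΩ hK (α := 1) (by decide)
  have p1 := fderiv_phaseDeriv hΩ hK.d_ne k0 p0
  have p2 := fderiv_phaseDeriv hΩ hK.d_ne k1 p1
  -- Integrating in the phase: `B''`, then `B' - c₂ τ`, then `B - c₁ τ - (c₂ / 2) τ²` are constant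
  -- on the connected set.
  obtain ⟨c₂, hc₂⟩ := exists_eq_const_of_fderiv hΩ hc k2 fun z hz b => by
    rw [p2 z hz, h.third_phaseDeriv hΩ hK hz, zero_mul]
  obtain ⟨c₁, hc₁⟩ := exists_eq_const_of_fderiv hΩ hc
    (k1.sub (contDiff_phasePoly n d 0 c₂ 0).contDiffOn) fun z hz b => by
    erw [fderiv_sub (ContDiffOn.differentiableAt_of_isOpen hΩ k1 hz)
      (differentiable_phasePoly n d 0 c₂ 0 z)]
    rw [sub_apply, p1 z hz, fderiv_phasePoly, hc₂ z hz]
    simp [phasePoly]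
  obtain ⟨c₀, hc₀⟩ := exists_eq_const_of_fderiv hΩ hc
    (k0.sub (contDiff_phasePoly n d 0 c₁ (c₂ / 2)).contDiffOn) fun z hz b => by
    have e := hc₁ z hz
    simp only [phasePoly] at e
    erw [fderiv_sub (ContDiffOn.differentiableAt_of_isOpen hΩ k0 hz)
      (differentiable_phasePoly n d 0 c₁ (c₂ / 2) z)]
    rw [sub_apply, p0 z hz, fderiv_phasePoly]
    simp only [phasePoly]
    linear_combination phaseForm n d b * e
  refine ⟨x, c₀, c₁, c₂ / 2, fun z hz => ?_⟩
  have e1 := hc₁ z hz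
  have e0 := hc₀ z hz
  simp only [phasePoly] at e0 e1
  have hu := h.uDeriv_zero hΩ hK hz
  have f := h.fibComp_eq hΩ hK hz
  have f2 := h.w_mul_fibComp_two hΩ hK z hz
  rw [hu] at f f2
  refine Prod.ext (funext fun i => hx i z hz) (funext fun i => ?_)
  match i with
  | 0 =>
    change fibComp V 0 z = -(z.2 1 * phasePoly n d c₀ c₁ (c₂ / 2) z)
    simp only [phasePoly]
    linear_combination f.1 - z.2 1 * e0
  | 1 =>
    change fibComp V 1 z = z.2 0 * phasePoly n d c₀ c₁ (c₂ / 2) z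
    simp only [phasePoly]
    linear_combination f.2 + z.2 0 * e0
  | 2 =>
    change fibComp V 2 z = (K.a₁ * d + K.a₅ * n) / K.w * phasePoly n d c₁ (2 * (c₂ / 2)) 0 z
    have hw := hK.w_ne
    simp only [phasePoly]
    field_simp
    linear_combination f2 + (K.a₁ * d + K.a₅ * n) * e1

end Coeffs

/-! ### The change of variables and the transformed equations. -/

section Change

variable {G : Type*} [NormedAddCommGroup G] [NormedSpace ℝ G]

theorem bijective_change {c d m : ℝ} (hm : 0 < m) (hdm : d ^ 2 - m ≠ 0) :
    Function.Bijective (change c d m) := by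
  have hs : √m ≠ 0 := (Real.sqrt_pos.2 hm).ne'
  rw [Function.bijective_iff_has_inverse]
  -- Cramer's rule; the determinant in the last two variables is `√m (m - d²)`.
  refine ⟨fun p => ![p 0, (p 2 * (c * d - 1) - d * p 1) / (d ^ 2 - m),
    (m * p 1 - (m * c - d) * p 2) / (√m * (d ^ 2 - m))], fun q => ?_, fun p => ?_⟩
  · funext i
    match i with
    | 0 => rfl
    | 1 =>
      simp [change]
      field_simp
      ring
    | 2 =>
      simp [change]
      field_simp
      ring
  · funext i
    match i with
    | 0 => rfl
    | 1 =>
      simp [change]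
      field_simp
      ring
    | 2 =>
      simp [change]
      field_simp
      ring

theorem hasFDerivAt_change (c d m : ℝ) (q : Base) : ∃ L : Base →L[ℝ] Base,
    HasFDerivAt (change c d m) L q ∧ ∀ v, L v = change c d m v := by
  let L₀ : Base →ₗ[ℝ] Base :=
    { toFun := change c d m
      map_add' := fun v w => by
        funext i
        match i with
        | 0 => simp [change]
        | 1 => simp [change]; ring
        | 2 => simp [change]; ring
      map_smul' := fun r v => by
        funext i
        match i with
        | 0 => simp [change]
        | 1 => simp [change]; ring
        | 2 => simp [change]; ring }
  exact ⟨L₀.toContinuousLinearMap, L₀.toContinuousLinearMap.hasFDerivAt, fun v => rfl⟩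

theorem contDiff_change (c d m : ℝ) : ContDiff ℝ ∞ (change c d m) := by
  refine contDiff_pi.2 fun i => ?_
  match i with
  | 0 => change ContDiff ℝ ∞ fun q : Base => q 0; fun_prop
  | 1 =>
    change ContDiff ℝ ∞ fun q : Base => (m * c - d) * q 1 + √m * (c * d - 1) * q 2
    fun_prop
  | 2 => change ContDiff ℝ ∞ fun q : Base => m * q 1 + d * √m * q 2; fun_prop

theorem pd_comp_change (c d m : ℝ) {F : Base → G} (hF : ContDiff ℝ ∞ F) (i : Fin 3) (q : Base) :
    pd i (fun r => F (change c d m r)) q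
      = fderiv ℝ F (change c d m q) (change c d m (Pi.single i 1)) := by
  obtain ⟨L, hL, hv⟩ := hasFDerivAt_change c d m q
  have h := (hF.differentiable (by simp) (change c d m q)).hasFDerivAt.comp q hL
  simp only [pd]
  erw [h.fderiv]
  simp [hv]

theorem fderiv_eq_pd (F : Base → G) (p v : Base) :
    fderiv ℝ F p v = v 0 • pd 0 F p + v 1 • pd 1 F p + v 2 • pd 2 F p := by
  have hv : v = v 0 • Pi.single 0 1 + v 1 • Pi.single 1 1 + v 2 • Pi.single 2 1 := by
    funext i
    match i with
    | 0 => simp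
    | 1 => simp
    | 2 => simp
  conv_lhs => rw [hv]
  simp only [map_add, map_smul, pd]

theorem pd_zero_comp_change (c d m : ℝ) {F : Base → G} (hF : ContDiff ℝ ∞ F) :
    pd 0 (fun r => F (change c d m r)) = fun q => pd 0 F (change c d m q) := by
  funext q
  rw [pd_comp_change c d m hF, fderiv_eq_pd]
  simp [change]

theorem pd_one_comp_change (c d m : ℝ) {F : Base → G} (hF : ContDiff ℝ ∞ F) :
    pd 1 (fun r => F (change c d m r))
      = fun q => (fun p => (m * c - d) • pd 1 F p + m • pd 2 F p) (change c d m q) := by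
  funext q
  rw [pd_comp_change c d m hF, fderiv_eq_pd]
  simp [change]

theorem pd_two_comp_change (c d m : ℝ) {F : Base → G} (hF : ContDiff ℝ ∞ F) :
    pd 2 (fun r => F (change c d m r))
      = fun q => (fun p => (√m * (c * d - 1)) • pd 1 F p + (d * √m) • pd 2 F p)
        (change c d m q) := by
  funext q
  rw [pd_comp_change c d m hF, fderiv_eq_pd]
  simp [change]

theorem pd_linear_combination (r s : ℝ) {F H : Base → G} (hF : ContDiff ℝ ∞ F)
    (hH : ContDiff ℝ ∞ H) (i : Fin 3) (p : Base) :
    pd i (fun p => r • F p + s • H p) p = r • pd i F p + s • pd i H p := by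
  have h := ((hF.differentiable (by simp) p).hasFDerivAt.const_smul r).add
    ((hH.differentiable (by simp) p).hasFDerivAt.const_smul s)
  simp only [pd]
  erw [h.fderiv]
  simp

theorem contDiff_linear_combination (r s : ℝ) {F H : Base → G} (hF : ContDiff ℝ ∞ F)
    (hH : ContDiff ℝ ∞ H) : ContDiff ℝ ∞ (fun p => r • F p + s • H p) := by
  fun_prop

/-- The second derivatives in the new variables. -/
theorem pd_pd_comp_change (c d m : ℝ) {F : Base → G} (hF : ContDiff ℝ ∞ F) (q : Base) :
    pd 0 (pd 0 (fun r => F (change c d m r))) q = pd 0 (pd 0 F) (change c d m q) ∧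
    pd 1 (pd 1 (fun r => F (change c d m r))) q
      = (m * c - d) ^ 2 • pd 1 (pd 1 F) (change c d m q)
        + (2 * (m * c - d) * m) • pd 2 (pd 1 F) (change c d m q)
        + m ^ 2 • pd 2 (pd 2 F) (change c d m q) ∧
    pd 2 (pd 2 (fun r => F (change c d m r))) q
      = (√m * (c * d - 1)) ^ 2 • pd 1 (pd 1 F) (change c d m q)
        + (2 * (√m * (c * d - 1)) * (d * √m)) • pd 2 (pd 1 F) (change c d m q)
        + (d * √m) ^ 2 • pd 2 (pd 2 F) (change c d m q) ∧
    pd 2 (pd 1 (fun r => F (change c d m r))) q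
      = ((√m * (c * d - 1)) * (m * c - d)) • pd 1 (pd 1 F) (change c d m q)
        + ((√m * (c * d - 1)) * m + (d * √m) * (m * c - d)) • pd 2 (pd 1 F) (change c d m q)
        + ((d * √m) * m) • pd 2 (pd 2 F) (change c d m q) := by
  have hd := fun i => contDiff_pd hF i
  have hl := fun r s => contDiff_linear_combination r s (hd 1) (hd 2)
  have hc : ∀ p, pd 1 (pd 2 F) p = pd 2 (pd 1 F) p := fun p => pd_comm hF.contDiffAt 1 2
  refine ⟨?_, ?_, ?_, ?_⟩
  · rw [pd_zero_comp_change c d m hF, pd_zero_comp_change c d m (hd 0)]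
  · rw [pd_one_comp_change c d m hF, pd_one_comp_change c d m (hl _ _)]
    simp only [pd_linear_combination _ _ (hd 1) (hd 2), hc]
    module
  · rw [pd_two_comp_change c d m hF, pd_two_comp_change c d m (hl _ _)]
    simp only [pd_linear_combination _ _ (hd 1) (hd 2), hc]
    module
  · rw [pd_one_comp_change c d m hF, pd_two_comp_change c d m (hl _ _)]
    simp only [pd_linear_combination _ _ (hd 1) (hd 2), hc]
    module

end Change

theorem pd_apply {f : Base → Fib} {p : Base} (hf : DifferentiableAt ℝ f p) (i α : Fin 3) :
    pd i f p α = pd i (fun q => f q α) p := by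
  have h := hasFDerivAt_pi'.1 hf.hasFDerivAt α
  simp only [pd]
  rw [h.fderiv]
  rfl

theorem toC_pd {f : Base → Fib} {p : Base} (hf : DifferentiableAt ℝ f p) (i : Fin 3) :
    toC (pd i f p) = pd i (fun q => toC (f q)) p := by
  let L₀ : Fib →ₗ[ℝ] ℂ :=
    { toFun := toC
      map_add' := fun v w => by apply Complex.ext <;> simp [toC]
      map_smul' := fun r v => by apply Complex.ext <;> simp [toC] }
  have h := L₀.toContinuousLinearMap.hasFDerivAt.comp p hf.hasFDerivAt
  simp only [pd]
  have e : HasFDerivAt (fun q => toC (f q)) _ p := h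
  rw [e.fderiv]
  rfl

theorem pd_pd_sq {u : Base → ℝ} (hu : ContDiff ℝ ∞ u) (i : Fin 3) (p : Base) :
    pd i (pd i (fun q => u q ^ 2)) p = 2 * (u p * pd i (pd i u) p + pd i u p ^ 2) := by
  have h1 : pd i (fun q => u q ^ 2) = fun q => 2 * (u q * pd i u q) := by
    funext q
    have h := (hu.differentiable (by simp) q).hasFDerivAt.pow 2
    simp only [pd]
    erw [h.fderiv]
    simp
    ring
  rw [h1]
  have h := ((hu.differentiable (by simp) p).hasFDerivAt.mul
    ((contDiff_pd hu i).differentiable (by simp) p).hasFDerivAt).const_mul 2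
  change fderiv ℝ (fun q => 2 * (u q * pd i u q)) p (Pi.single i 1) = _
  erw [h.fderiv]
  simp [pd]
  ring

section Transform

variable {a b c ε₀ d m w : ℝ} {ψ : Base → ℂ} {φ : Base → ℝ}

theorem contDiff_transform (hψ : ContDiff ℝ ∞ ψ) (hφ : ContDiff ℝ ∞ φ) :
    ContDiff ℝ ∞ (transform c d m ψ φ) := by
  have hc := contDiff_change c d m
  refine contDiff_pi.2 fun i => ?_
  match i with
  | 0 => exact Complex.reCLM.contDiff.comp (hψ.comp hc)
  | 1 => exact Complex.imCLM.contDiff.comp (hψ.comp hc)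
  | 2 => exact contDiff_pd (hφ.comp hc) 1

/-- The chain rule gives `d ∂_ξ - √m ∂_η = (m - d²) ∂_y` and `a₁ ∂_η + a₅ ∂_ξ = ∂_t`; the square of
the first identity accounts for `a₂`, `a₃`, `a₄`. -/
theorem eqA_transform (hm : 0 < m) (hdm : d ^ 2 - m ≠ 0) (hψ : ContDiff ℝ ∞ ψ)
    (hφ : ContDiff ℝ ∞ φ) (h : SolvesOriginal a b c ε₀ d m w ψ φ) (p : Base) :
    eqA a b c ε₀ d m w (jet (transform c d m ψ φ) p) = 0 := by
  have hf := contDiff_transform (c := c) (d := d) (m := m) hψ hφ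
  have hfd : ∀ q, DifferentiableAt ℝ (transform c d m ψ φ) q := hf.differentiable (by simp)
  have ht : (fun q => toC (transform c d m ψ φ q)) = fun q => ψ (change c d m q) := rfl
  have h1 : ∀ i q, toC (pd i (transform c d m ψ φ) q) = pd i (fun q => ψ (change c d m q)) q :=
    fun i q => toC_pd (hfd q) i
  have h2 : ∀ i j, toC (pd i (pd j (transform c d m ψ φ)) p)
      = pd i (pd j (fun q => ψ (change c d m q))) p := by
    intro i j
    rw [toC_pd ((contDiff_pd hf j).differentiable (by simp) p)]
    simp only [h1]
  obtain ⟨g00, g11, g22, g21⟩ := pd_pd_comp_change c d m hψ p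
  have hs : (√m : ℂ) ^ 2 = m := by exact_mod_cast Real.sq_sqrt hm.le
  have hs0 : (√m : ℂ) ≠ 0 := by exact_mod_cast (Real.sqrt_pos.2 hm).ne'
  have hD : ((d : ℂ) ^ 2 - m) ≠ 0 := by exact_mod_cast hdm
  have h0 := (h (change c d m p)).1
  have e2 : transform c d m ψ φ p 2 = m * pd 2 φ (change c d m p)
      + (m * c - d) * pd 1 φ (change c d m p) := by
    change pd 1 (fun r => φ (change c d m r)) p = _
    rw [pd_one_comp_change c d m hφ]
    simp only [smul_eq_mul]
    ring
  have e0 : toC (transform c d m ψ φ p) = ψ (change c d m p) := rfl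
  simp only [eqA, jet, h1, h2, g00, g11, g22, g21, e0, e2]
  simp only [pd_one_comp_change c d m hψ, pd_two_comp_change c d m hψ]
  rw [← sub_eq_zero] at h0
  rw [← h0]
  simp only [Complex.real_smul]
  push_cast
  -- Writing `m = S²` makes the claim an identity of rational functions.
  set S := (√m : ℂ)
  rw [← hs] at hD ⊢
  field_simp
  ring

theorem eqB_transform (hm : 0 < m) (hdm : d ^ 2 - m ≠ 0) (hψ : ContDiff ℝ ∞ ψ)
    (hφ : ContDiff ℝ ∞ φ) (h : SolvesOriginal a b c ε₀ d m w ψ φ) (p : Base) :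
    eqB d m (jet (transform c d m ψ φ) p) = 0 := by
  have hf := contDiff_transform (c := c) (d := d) (m := m) hψ hφ
  have hc := contDiff_change c d m
  set f := transform c d m ψ φ with hfdef
  have hfd : ∀ q, DifferentiableAt ℝ f q := hf.differentiable (by simp)
  have h1 : ∀ i α q, pd i f q α = pd i (fun q => f q α) q := fun i α q => pd_apply (hfd q) i α
  have h2 : ∀ i j α, pd i (pd j f) p α = pd i (pd j (fun q => f q α)) p := by
    intro i j α
    rw [pd_apply ((contDiff_pd hf j).differentiable (by simp) p)]
    simp only [h1]
  set Φ : Base → ℝ := fun r => φ (change c d m r) with hΦ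
  have hΦs : ContDiff ℝ ∞ Φ := hφ.comp hc
  have hN : ContDiff ℝ ∞ fun q => ‖ψ q‖ ^ 2 := hψ.norm_sq ℝ
  have f2 : (fun q => f q 2) = pd 1 Φ := rfl
  have hD : √m ^ 2 = m := Real.sq_sqrt hm.le
  -- In the new variables the mixed derivative drops out and the source is `∂_ξ |ψ|²`; one more
  -- `∂_ξ` gives the equation for `Φ_ξ`.
  have hwave : ∀ q, pd 0 (pd 0 Φ) q + 1 / (d ^ 2 - m) * (pd 1 (pd 1 Φ) q - pd 2 (pd 2 Φ) q)
      = pd 1 (fun r => ‖ψ (change c d m r)‖ ^ 2) q := by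
    intro q
    obtain ⟨g00, g11, g22, g21⟩ := pd_pd_comp_change c d m hφ q
    have h0 := (h (change c d m q)).2
    rw [pd_one_comp_change c d m hN, g00, g11, g22]
    simp only [smul_eq_mul, mul_pow, hD]
    rw [show ∀ x y : ℝ, (m * c - d) * x + m * y = m * y + (m * c - d) * x from
      fun x y => add_comm _ _, ← h0]
    field_simp
    linear_combination (2 * (c * d - 1) * d) * pd 2 (pd 1 φ) (change c d m q) * (-hD)
  have hsq : (fun r => ‖ψ (change c d m r)‖ ^ 2) = fun r => f r 0 ^ 2 + f r 1 ^ 2 := by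
    funext r
    rw [← Complex.normSq_eq_norm_sq, Complex.normSq_apply, sq, sq]
    rfl
  have hf0 : ContDiff ℝ ∞ fun q => f q 0 := contDiff_pi.1 hf 0
  have hf1 : ContDiff ℝ ∞ fun q => f q 1 := contDiff_pi.1 hf 1
  have hrhs : pd 1 (pd 1 (fun r => ‖ψ (change c d m r)‖ ^ 2)) p
      = 2 * (f p 0 * pd 1 (pd 1 fun q => f q 0) p + pd 1 (fun q => f q 0) p ^ 2)
        + 2 * (f p 1 * pd 1 (pd 1 fun q => f q 1) p + pd 1 (fun q => f q 1) p ^ 2) := by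
    have e : pd 1 (fun r => f r 0 ^ 2 + f r 1 ^ 2)
        = fun q => pd 1 (fun r => f r 0 ^ 2) q + pd 1 (fun r => f r 1 ^ 2) q := funext fun q =>
      pd_add ((hf0.pow 2).differentiable (by simp) q) ((hf1.pow 2).differentiable (by simp) q) 1
    rw [hsq, e, pd_add ((contDiff_pd (hf0.pow 2) 1).differentiable (by simp) p)
      ((contDiff_pd (hf1.pow 2) 1).differentiable (by simp) p), pd_pd_sq hf0, pd_pd_sq hf1]
  have hcomm : ∀ i, pd 1 (pd i (pd i Φ)) p = pd i (pd i (pd 1 Φ)) p := by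
    intro i
    rw [pd_comm (contDiff_pd hΦs i).contDiffAt]
    congr 1
    exact funext fun q => pd_comm hΦs.contDiffAt 1 i
  have hs := fun i => contDiff_pd (contDiff_pd hΦs i) i
  have hlhs : pd 1 (fun q => pd 0 (pd 0 Φ) q
      + 1 / (d ^ 2 - m) * (pd 1 (pd 1 Φ) q - pd 2 (pd 2 Φ) q)) p
      = pd 0 (pd 0 (pd 1 Φ)) p
        + 1 / (d ^ 2 - m) * (pd 1 (pd 1 (pd 1 Φ)) p - pd 2 (pd 2 (pd 1 Φ)) p) := by
    have hd := fun i => (hs i).differentiable (by simp) p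
    have hl := pd_linear_combination 1 (1 / (d ^ 2 - m)) (hs 0) ((hs 1).sub (hs 2)) 1 p
    simp only [smul_eq_mul, one_mul] at hl
    rw [hl, ← hcomm 0, ← hcomm 2]
    congr 2
    exact pd_sub (hd 1) (hd 2) 1
  rw [funext hwave, hrhs] at hlhs
  simp only [eqB, jet, h1, h2, f2]
  linear_combination -hlhs

end Transform

/-! ### The actual coefficients, the six generators and their span. -/

theorem nondegenerate_coeffs {a b c ε₀ d m w : ℝ} (ha : a ≠ 0) (hε₀ : 0 < ε₀) (hd : 0 < d)
    (hm : 0 < m) (hw : 0 < w) (hdm : d ^ 2 - m ≠ 0) :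
    (coeffs a b c ε₀ d m w).Nondegenerate √m d := by
  have hs : √m ≠ 0 := (Real.sqrt_pos.2 hm).ne'
  have hD : √m ^ 2 = m := Real.sq_sqrt hm.le
  have hd0 := hd.ne'
  have he := hε₀.ne'
  refine ⟨ha, ?_, ?_, hw.ne', ?_, hs, hd0, ?_, ?_, ?_, ?_⟩ <;> try simp only [coeffs]
  · refine div_ne_zero (neg_ne_zero.2 ?_) (pow_ne_zero _ hdm)
    positivity
  · exact div_ne_zero one_ne_zero hdm
  · have e : ε₀ * d ^ 2 / (d ^ 2 - m) ^ 2 - ε₀ * m / (d ^ 2 - m) ^ 2 = ε₀ / (d ^ 2 - m) := by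
      field_simp
    rw [e]
    exact div_ne_zero he hdm
  · rw [hD]
    exact fun h => hdm (by linear_combination -h)
  · field_simp
    ring
  · field_simp
    linear_combination (-2 * ε₀ * d) * hD
  -- The drift is `1 / √m`, whatever `c` is.
  · have e : (d - m * c) / ((d ^ 2 - m) * √m) * d + (d * c - 1) / (d ^ 2 - m) * √m = 1 / √m := by
      field_simp
      linear_combination (d * c - 1) * hD
    rw [e]
    exact one_div_ne_zero hs

theorem drift_coeffs {a b c ε₀ d m w : ℝ} (hm : 0 < m) (hdm : d ^ 2 - m ≠ 0) :
    ((coeffs a b c ε₀ d m w).a₁ * d + (coeffs a b c ε₀ d m w).a₅ * √m) / (coeffs a b c ε₀ d m w).w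
      = 1 / (w * √m) := by
  have hs : √m ≠ 0 := (Real.sqrt_pos.2 hm).ne'
  have hD : √m ^ 2 = m := Real.sq_sqrt hm.le
  have e : (d - m * c) / ((d ^ 2 - m) * √m) * d + (d * c - 1) / (d ^ 2 - m) * √m = 1 / √m := by
    field_simp
    linear_combination (d * c - 1) * hD
  simp only [coeffs, e]
  rw [div_div, mul_comm]

section Generators

variable (d m w : ℝ)

/-- The generators list the translations in the order `t`, `x`, `y`, whence the permuted entries `r
1`, `r 2`, `r 0`. -/
theorem sum_smul_gen (r : Fin 6 → ℝ) : ∑ i, r i • gen d m w i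
    = symField √m d (1 / (w * √m)) ![r 1, r 2, r 0] (r 3) (r 4) (r 5) := by
  funext z
  refine Prod.ext (funext fun i => ?_) (funext fun i => ?_) <;>
  · fin_cases i <;> simp [Fin.sum_univ_succ, gen, symField, rot, dφ, phase, phasePoly, phaseForm]
      <;> ring

theorem gen_eq_symField (i : Fin 6) : gen d m w i
    = symField √m d (1 / (w * √m)) ![(Pi.single i 1 : Fin 6 → ℝ) 1, (Pi.single i 1 : Fin 6 → ℝ) 2,
      (Pi.single i 1 : Fin 6 → ℝ) 0] ((Pi.single i 1 : Fin 6 → ℝ) 3)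
      ((Pi.single i 1 : Fin 6 → ℝ) 4) ((Pi.single i 1 : Fin 6 → ℝ) 5) := by
  rw [← sum_smul_gen]
  simp [Pi.single_apply]

theorem symField_eq_sum (x : Base) (c₀ c₁ c₂ : ℝ) :
    symField √m d (1 / (w * √m)) x c₀ c₁ c₂ = ∑ i, ![x 2, x 0, x 1, c₀, c₁, c₂] i • gen d m w i := by
  rw [sum_smul_gen]
  congr 1
  funext i
  fin_cases i <;> rfl

theorem linearIndependent_gen {d m w : ℝ} (hd : 0 < d) (hm : 0 < m) (hw : 0 < w) {Ω : Set Total}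
    (hΩ : IsOpen Ω) (hne : Ω.Nonempty) :
    LinearIndependent ℝ fun i => Ω.domRestrict (gen d m w i) := by
  rw [Fintype.linearIndependent_iff]
  intro r hr
  have h : ∀ z ∈ Ω,
      symField √m d (1 / (w * √m)) ![r 1, r 2, r 0] (r 3) (r 4) (r 5) z = 0 := by
    intro z hz
    rw [← sum_smul_gen]
    have := congrFun hr ⟨z, hz⟩
    simpa [Finset.sum_apply] using this
  obtain ⟨z, hz⟩ := hne
  -- A second point of `Ω`, with both the phase and `u` increased by `s ≠ 0`: comparing
  -- `φ`-components gives `r 5` and `r 4`, comparing `v`-components then gives `r 3`.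
  obtain ⟨s, hs0, hs⟩ : ∃ s : ℝ, s ≠ 0 ∧ z + s • (phaseVec d + fibVec 0) ∈ Ω := by
    have hc : ContinuousAt (fun s : ℝ => z + s • (phaseVec d + fibVec 0)) 0 := by fun_prop
    have h1 : ∀ᶠ s in 𝓝[≠] (0 : ℝ), z + s • (phaseVec d + fibVec 0) ∈ Ω :=
      (hc.eventually (hΩ.mem_nhds (by simpa using hz))).filter_mono nhdsWithin_le_nhds
    obtain ⟨s, hs, hs0⟩ := (h1.and self_mem_nhdsWithin).exists
    exact ⟨s, hs0, hs⟩
  have hk : 1 / (w * √m) ≠ 0 := by positivity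
  have hd0 := hd.ne'
  have A := h z hz
  have B := h _ hs
  have p : phaseForm √m d (z + s • (phaseVec d + fibVec 0)) = phaseForm √m d z + s := by
    simp [phaseForm, phaseVec, baseVec, fibVec]
    field_simp
    ring
  have q : (z + s • (phaseVec d + fibVec 0)).2 0 = z.2 0 + s := by
    simp [phaseVec, baseVec, fibVec]
  have A0 := congrArg (fun y : Total => y.1 0) A
  have A1 := congrArg (fun y : Total => y.1 1) A
  have A2 := congrArg (fun y : Total => y.1 2) A
  have A4 := congrArg (fun y : Total => y.2 1) A
  have A5 := congrArg (fun y : Total => y.2 2) A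
  have B4 := congrArg (fun y : Total => y.2 1) B
  have B5 := congrArg (fun y : Total => y.2 2) B
  simp only [symField, phasePoly, p, q] at A0 A1 A2 A4 A5 B4 B5
  simp at A0 A1 A2
  have C5 := (mul_eq_zero.1 (show 1 / (w * √m) * _ = 0 from A5)).resolve_left hk
  have D5 := (mul_eq_zero.1 (show 1 / (w * √m) * _ = 0 from B5)).resolve_left hk
  have h5 : r 5 = 0 := by
    refine mul_left_cancel₀ hs0 ?_
    linear_combination (D5 - C5) / 2
  rw [h5] at C5
  have h4 : r 4 = 0 := by linear_combination C5
  rw [h5, h4] at A4 B4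
  have A4' : z.2 0 * (r 3 + 0 * phaseForm √m d z + 0 * phaseForm √m d z ^ 2) = 0 := A4
  have B4' : (z.2 0 + s) * (r 3 + 0 * (phaseForm √m d z + s) + 0 * (phaseForm √m d z + s) ^ 2) = 0 :=
    B4
  have h3 : r 3 = 0 := by
    refine mul_left_cancel₀ hs0 ?_
    linear_combination B4' - A4'
  intro i
  fin_cases i
  exacts [A2, A0, A1, h3, h4, h5]

end Generators

section Algebra

variable {a b c ε₀ d m w : ℝ}

theorem isLieSymmetry_iff (ha : a ≠ 0) (hε₀ : 0 < ε₀) (hd : 0 < d)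
    (hm : 0 < m) (hw : 0 < w) (hdm : d ^ 2 - m ≠ 0) {Ω : Set Total} (hΩ : IsOpen Ω)
    (hc : IsConnected Ω) (V : Total → Total) :
    IsLieSymmetry (system a b c ε₀ d m w) Ω V ↔ ∃ (x : Base) (c₀ c₁ c₂ : ℝ),
      ∀ z ∈ Ω, V z = symField √m d (1 / (w * √m)) x c₀ c₁ c₂ z := by
  have hK := nondegenerate_coeffs (b := b) (c := c) ha hε₀ hd hm hw hdm
  rw [isLieSymmetry_system_iff a b c ε₀ d m w hΩ, ← drift_coeffs (a := a) (b := b) (c := c)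
    (ε₀ := ε₀) hm hdm]
  refine ⟨fun h => h.exists_eq_symField hΩ hc hK, ?_⟩
  rintro ⟨x, c₀, c₁, c₂, h⟩
  exact (Coeffs.isSymmetry_symField hK Ω x c₀ c₁ c₂).congr hΩ h

theorem mem_span_gen_iff {Ω : Set Total} (V : Total → Total) :
    Ω.domRestrict V ∈ Submodule.span ℝ (Set.range fun i => Ω.domRestrict (gen d m w i)) ↔
      ∃ (x : Base) (c₀ c₁ c₂ : ℝ), ∀ z ∈ Ω,
        V z = symField √m d (1 / (w * √m)) x c₀ c₁ c₂ z := by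
  rw [Submodule.mem_span_range_iff_exists_fun]
  have hsum : ∀ r : Fin 6 → ℝ, ∑ i, r i • Ω.domRestrict (gen d m w i)
      = Ω.domRestrict (∑ i, r i • gen d m w i) := by
    intro r
    funext z
    simp [Finset.sum_apply]
  constructor
  · rintro ⟨r, hr⟩
    refine ⟨![r 1, r 2, r 0], r 3, r 4, r 5, fun z hz => ?_⟩
    rw [← sum_smul_gen]
    rw [hsum] at hr
    exact (congrFun hr ⟨z, hz⟩).symm
  · rintro ⟨x, c₀, c₁, c₂, h⟩
    refine ⟨![x 2, x 0, x 1, c₀, c₁, c₂], ?_⟩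
    rw [hsum, ← symField_eq_sum]
    funext z
    exact (h z z.2).symm

theorem lieBracket_mem_span_gen {Ω : Set Total} (hΩ : IsOpen Ω) {V W : Total → Total}
    (hV : Ω.domRestrict V ∈ Submodule.span ℝ (Set.range fun i => Ω.domRestrict (gen d m w i)))
    (hW : Ω.domRestrict W ∈ Submodule.span ℝ (Set.range fun i => Ω.domRestrict (gen d m w i))) :
    Ω.domRestrict (VectorField.lieBracket ℝ V W)
      ∈ Submodule.span ℝ (Set.range fun i => Ω.domRestrict (gen d m w i)) := by
  rw [mem_span_gen_iff] at hV hW ⊢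
  obtain ⟨x, c₀, c₁, c₂, hV⟩ := hV
  obtain ⟨x', c₀', c₁', c₂', hW⟩ := hW
  refine ⟨0, phaseForm √m d (x, 0) * c₁' - phaseForm √m d (x', 0) * c₁,
    2 * (phaseForm √m d (x, 0) * c₂' - phaseForm √m d (x', 0) * c₂), 0, fun z hz => ?_⟩
  rw [Filter.EventuallyEq.lieBracket_vectorField_eq
    (Filter.eventually_of_mem (hΩ.mem_nhds hz) hV) (Filter.eventually_of_mem (hΩ.mem_nhds hz) hW),
    lieBracket_symField]

theorem smul_symField (n d k r : ℝ) (x : Base) (c₀ c₁ c₂ : ℝ) :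
    r • symField n d k x c₀ c₁ c₂ = symField n d k (r • x) (r * c₀) (r * c₁) (r * c₂) := by
  funext z
  refine Prod.ext rfl (funext fun i => ?_)
  fin_cases i <;> simp [symField, phasePoly] <;> ring

theorem symField_zero (n d k : ℝ) : symField n d k 0 0 0 0 = 0 := by
  funext z
  refine Prod.ext rfl (funext fun i => ?_)
  fin_cases i <;> simp [symField, phasePoly]

end Algebra
end BRZR
end

theorem mainTheorem3 (a b c ε₀ d m w : ℝ) (ha : a ≠ 0) (hb : b ≠ 0) (hc : c ≠ 0)
    (hε₀ : 0 < ε₀) (hd : 0 < d) (hm : 0 < m) (hw : 0 < w) (hdm : d ^ 2 - m ≠ 0) :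
    -- the change of variables is invertible and leads to the transformed system
    (Function.Bijective (BRZR.change c d m) ∧
      ∀ (ψ : BRZR.Base → ℂ) (φ : BRZR.Base → ℝ), ContDiff ℝ ∞ ψ → ContDiff ℝ ∞ φ →
        BRZR.SolvesOriginal a b c ε₀ d m w ψ φ →
          ∀ p, BRZR.system a b c ε₀ d m w (BRZR.jet (BRZR.transform c d m ψ φ) p) = 0) ∧
    -- on each domain, the infinitesimal symmetries form a six-dimensional Lie algebra
    (∀ Ω : Set BRZR.Total, IsOpen Ω → IsConnected Ω →
      ∃ 𝔤 : Submodule ℝ (Ω → BRZR.Total),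
        (∀ V : BRZR.Total → BRZR.Total,
          Ω.domRestrict V ∈ 𝔤 ↔ BRZR.IsLieSymmetry (BRZR.system a b c ε₀ d m w) Ω V) ∧
        (∀ V W : BRZR.Total → BRZR.Total, Ω.domRestrict V ∈ 𝔤 → Ω.domRestrict W ∈ 𝔤 →
          Ω.domRestrict (VectorField.lieBracket ℝ V W) ∈ 𝔤) ∧
        Module.finrank ℝ 𝔤 = 6 ∧
        ∃ B : Module.Basis (Fin 6) ℝ 𝔤,
          ∀ i, (B i : Ω → BRZR.Total) = Ω.domRestrict (BRZR.gen d m w i)) ∧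
    -- the commutators
    (VectorField.lieBracket ℝ (BRZR.gen d m w 0) (BRZR.gen d m w 4) = d • BRZR.gen d m w 3 ∧
     VectorField.lieBracket ℝ (BRZR.gen d m w 0) (BRZR.gen d m w 5) = (2 * d) • BRZR.gen d m w 4 ∧
     VectorField.lieBracket ℝ (BRZR.gen d m w 2) (BRZR.gen d m w 4) = √m • BRZR.gen d m w 3 ∧
     VectorField.lieBracket ℝ (BRZR.gen d m w 2) (BRZR.gen d m w 5) = (2 * √m) • BRZR.gen d m w 4 ∧
      ∀ i j : Fin 6, i < j →
        (i, j) ∉ ({(0, 4), (0, 5), (2, 4), (2, 5)} : Set (Fin 6 × Fin 6)) →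
         VectorField.lieBracket ℝ (BRZR.gen d m w i) (BRZR.gen d m w j) = 0) := by
  refine ⟨⟨BRZR.bijective_change hm hdm, fun ψ φ hψ hφ h p => Prod.ext
    (BRZR.eqA_transform hm hdm hψ hφ h p) (BRZR.eqB_transform hm hdm hψ hφ h p)⟩,
    fun Ω hΩ hconn => ?_, ?_⟩
  · have hli := BRZR.linearIndependent_gen hd hm hw hΩ hconn.nonempty
    refine ⟨Submodule.span ℝ (Set.range fun i => Ω.domRestrict (BRZR.gen d m w i)), fun V => ?_,
      fun V W hV hW => BRZR.lieBracket_mem_span_gen hΩ hV hW, ?_,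
      Module.Basis.span hli, fun i => congrArg Subtype.val (Module.Basis.span_apply hli i)⟩
    · rw [BRZR.mem_span_gen_iff, BRZR.isLieSymmetry_iff ha hε₀ hd hm hw hdm hΩ hconn]
    · rw [Module.finrank_eq_card_basis (Module.Basis.span hli), Fintype.card_fin]
  · have h0 : (![0, 0, 0] : BRZR.Base) = 0 := funext fun i => by fin_cases i <;> rfl
    -- All brackets are instances of `lieBracket_symField`; the translations in `t` and `y` change
    -- the phase at rates `d` and `√m`, the one in `x` does not.
    simp only [BRZR.gen_eq_symField, BRZR.smul_symField, BRZR.lieBracket_symField]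
    refine ⟨?_, ?_, ?_, ?_, fun i j hij hne => ?_⟩
    · simp [BRZR.phaseForm, h0]
    · simp [BRZR.phaseForm, h0]
    · simp [BRZR.phaseForm, h0]
    · simp [BRZR.phaseForm, h0]
    · rw [← BRZR.symField_zero √m d (1 / (w * √m))]
      fin_cases i <;> fin_cases j <;>
        simp [BRZR.phaseForm] at hij hne ⊢
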